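/- Let $X=(X,d,\mu)$ be a complete, unbounded metric space with a Borel measure $\mu$ such that $0<\mu(B)<\infty$ for every closed ball $B=B(x,r)=\{y: d(x,y)\le r\}$, $r>0$, and such that $\mu$ is doubling, i.e. $\mu(B(x,2r))\le C\mu(B(x,r))$ for all $x\in X$, $r>0$, with $C$ independent of $x,r$. For $A\subset X$ and $f\colon A\to\mathbb R$, a Borel function $g\ge 0$ (with values in $[0,\infty]$) is an upper gradient of $f$ in $A$ if $|f(y)-f(x)|\le\int_\gamma g\,ds$ for every compact rectifiable curve $\gamma$ in $A$ with endpoints $x,y$. For $q\ge1$, $X$ supports a $q$-Poincaré inequality if there are $C>0$, $\lambda\ge1$ such that, for every Borel function $f\colon X\to\mathbb R$ that is integrable on balls, every upper gradient $g$ of $f$ in $X$ and every ball $B=B(x,r)$, \[ \frac1{\mu(B)}\int_B|f-f_B|\,d\mu\le C\,r\Bigl(\frac1{\mu(\lambda B)}\int_{\lambda B}g^q\,d\mu\Bigr)^{1/q},\qquad f_B=\frac1{\mu(B)}\int_Bf\,d\mu,\quad \lambda B=B(x,\lambda r). \] For $E\subset X$ put $E_r=\{x: \operatorname{dist}(x,E)<r\}$,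 and let the lower Assouad codimension $\underline{\operatorname{co\,dim}}_A(E)\in[0,\infty]$ be the supremum of all $t\ge0$ for which there is a constant $C\ge1$ with \[ \frac{\mu(E_r\cap B(x,R))}{\mu(B(x,R))}\le C\Bigl(\frac rR\Bigr)^t\qquad\text{for all }x\in E\text{ and all }0<r<R<\infty. \] Let $1\le p<\infty$ and $\beta<p-1$. If $\beta\le0$, assume that $X$ supports a $p$-Poincaré inequality; if $\beta>0$, assume that $X$ supports a $(p-\beta)$-Poincaré inequality. Let $\Omega\subset X$ be an open set with $\underline{\operatorname{co\,dim}}_A(\Omega^c)>p-\beta$, where $\Omega^c=X\setminus\Omega$, and write $d_\Omega(x)=\operatorname{dist}(x,\Omega^c)$ (with $\operatorname{dist}(x,\emptyset)=\infty$). Then the $(p,\beta)$-Hardy inequality holds for all $u\in\operatorname{Lip}_b(\Omega)$: there is a constant $C>0$ such that \[ \int_\Omega|u|^p\,d_\Omega^{\beta-p}\,d\mu\le C\int_\Omega g_u^p\,d_\Omega^{\beta}\,d\mu \] for every Lipschitz function $u\colon\Omega\to\mathbb R$ with bounded support and every upper gradient $g_u$ of $u$ in $\Omega$. In particular, the test functions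 need not vanish on $\Omega^c$. -/

import Mathlib

open MeasureTheory Metric Set
open scoped NNReal ENNReal

/-- `μ` is doubling: `μ(B(x,2r)) ≤ C μ(B(x,r))` for all closed balls of `X`. -/
def IsDoublingMeasure {X : Type*} [MetricSpace X] [MeasurableSpace X] (μ : Measure X) : Prop :=
  ∃ C : ℝ≥0, ∀ (x : X) (r : ℝ), 0 < r →
    μ (closedBall x (2 * r)) ≤ (C : ℝ≥0∞) * μ (closedBall x r)

/-- The Borel function `g ≥ 0` is an upper gradient of `f` in the set `A`: the inequality
`|f(y) - f(x)| ≤ ∫_γ g ds` holds along every compact rectifiable curve `γ` contained in `A`,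
where `x` and `y` are the endpoints of `γ`. Curves are parametrized by arc length on `[0, l]`, so
that `∫_γ g ds` is the integral of `g ∘ γ` over `[0, l]`. Only the values of `f` and `g` in `A`
matter. -/
def IsUpperGradientOn {X : Type*} [MetricSpace X] [MeasurableSpace X]
    (g : X → ℝ≥0∞) (f : X → ℝ) (A : Set X) : Prop :=
  Measurable g ∧
    ∀ (l : ℝ) (γ : ℝ → X), 0 ≤ l → HasUnitSpeedOn γ (Icc 0 l) → MapsTo γ (Icc 0 l) A →
      edist (f (γ 0)) (f (γ l)) ≤ ∫⁻ t in Icc 0 l, g (γ t)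

/-- `X` supports a `(1,q)`-Poincaré inequality. The functions `f` are those for which all the
mean values `f_B` make sense. -/
def SupportsPoincare {X : Type*} [MetricSpace X] [MeasurableSpace X]
    (μ : Measure X) (q : ℝ) : Prop :=
  ∃ (C : ℝ≥0) (lam : ℝ), 1 ≤ lam ∧
    ∀ (f : X → ℝ) (g : X → ℝ≥0∞), Measurable f →
      (∀ (x : X) (r : ℝ), IntegrableOn f (closedBall x r) μ) →
      IsUpperGradientOn g f univ →
      ∀ (x : X) (r : ℝ), 0 < r →
        (⨍⁻ y in closedBall x r, ‖f y - ⨍ z in closedBall x r, f z ∂μ‖ₑ ∂μ) ≤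
          (C : ℝ≥0∞) * ENNReal.ofReal r *
            (⨍⁻ y in closedBall x (lam * r), g y ^ q ∂μ) ^ (1 / q)

/-- The lower Assouad codimension of a subset `E` of an unbounded space: the supremum of all
`t ≥ 0` such that `μ(E_r ∩ B(x,R)) / μ(B(x,R)) ≤ C (r/R)^t` for all `x ∈ E` and `0 < r < R`,
where `E_r` is the open `r`-neighbourhood of `E`. All scales `0 < r < R < ∞` are used. If `E` is
unbounded, this is the range `0 < r < R < diam E`; if `E` is bounded (for instance one point),
the scales above `diam E` are taken into account as well. -/
noncomputable def lowerAssouadCodim {X : Type*} [MetricSpace X] [MeasurableSpace X]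
    (μ : Measure X) (E : Set X) : ℝ≥0∞ :=
  ⨆ (t : ℝ≥0) (_ : ∃ C : ℝ≥0, ∀ x ∈ E, ∀ r R : ℝ, 0 < r → r < R →
      μ (thickening r E ∩ closedBall x R) / μ (closedBall x R) ≤
        (C : ℝ≥0∞) * ENNReal.ofReal ((r / R) ^ (t : ℝ))), (t : ℝ≥0∞)

/-- `Lip_b(Ω)`: the functions that are Lipschitz on `Ω` and have bounded support in `Ω`. Functions
on `Ω` are represented by functions on `X` whose values outside `Ω` are irrelevant. -/
def LipB {X : Type*} [MetricSpace X] (Ω : Set X) : Set (X → ℝ) :=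
  {u | (∃ L : ℝ≥0, LipschitzOnWith L u Ω) ∧ Bornology.IsBounded {x ∈ Ω | u x ≠ 0}}

/-- A `(p,β)`-Hardy inequality holds in `Ω` for all test functions `u ∈ F`, with one constant for
all `u ∈ F` and all upper gradients `g` of `u` in `Ω`. The distance to the complement is
`d_Ω(x) = infEDist x Ωᶜ`, a positive finite number at each point of an open set `Ω ≠ X`. -/
def HardyInequalityFor {X : Type*} [MetricSpace X] [MeasurableSpace X]
    (μ : Measure X) (Ω : Set X) (p β : ℝ) (F : Set (X → ℝ)) : Prop :=
  ∃ C : ℝ≥0, 0 < C ∧ ∀ u ∈ F, ∀ g : X → ℝ≥0∞, IsUpperGradientOn g u Ω →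
    ∫⁻ x in Ω, ‖u x‖ₑ ^ p * infEDist x Ωᶜ ^ (β - p) ∂μ ≤
      (C : ℝ≥0∞) * ∫⁻ x in Ω, g x ^ p * infEDist x Ωᶜ ^ β ∂μ

/-! ### Increment estimates along curves parametrized by arc length -/

section Curves

open Filter Topology

/-! Write `E = Ωᶜ` and let `d` be the distance to `E`. The inequality is first proved for test
functions `v` that vanish near `E` and have an upper gradient `h` on all of `X`; the sign of `β`
decides the method.

Negative `β`. Since `μ X = ∞`, the averages of `v` over large balls tend to `0`, so telescoping over
all dyadic scales and the `q`-Poincaré inequality bound `|v x|` by the sum of `2^m * (⨍ h^q)^(1/q)`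
over the balls `B(x, λ 2^m)` (`SupportsPoincare.exists_enorm_le_tsum`). The sum is raised to the
power `q` at the cost of factors `(2^m/d)^(±δ)` (`tsum_rpow_le_tsum_scale`), multiplied by
`d^(β-q)`, and integrated; by doubling, the average passes from `h^q` to the weight
(`lintegral_mul_laverage_le`). The Poincaré exponent stays `q` throughout, so neither a maximal
function nor self-improvement is needed. The codimension condition makes negative powers of `d`,
with exponents below `t`, integrable near `E` with the right scaling
(`exists_lintegral_infDist_rpow_le`). The scales above `d` then sum to a multiple of `d^β` because
`β < 0`, with a constant of order `1/|β|` as `β → 0`; the scales below `d` cause no blow-up.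

`β = 0`. The inequality with weight exponent `-ε` is applied to `v * d^(ε/q)`. The left side becomes
the unweighted one, and differentiating the power of `d` adds to the right side at most a constant
times `ε^(-1) * ε^q` times the left side. As `q > 1`, a small `ε` lets this term be absorbed
(`exists_hardyAwayFrom_zero`).

Positive `β`. The unweighted inequality with exponent `q = p - β > 1` is applied to `|v|^(p/q)`, and
Hölder's inequality finishes (`HardyAwayFrom.exists_of_pos`).

A general `u` in `LipB Ω` is then cut off in the strip `d < 2ε`. The extra gradient term is
controlled by the integral of `|u|^p d^(β-p)` over the strip. This function is integrable because
the codimension exceeds `p - β`, so the term vanishes as `ε → 0`, whatever the boundary behaviour of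
`u` (`HardyAwayFrom.lintegral_le_of_mem_LipB`). -/

theorem lintegral_Icc_add_lintegral_Icc {K : ℝ → ℝ≥0∞} {a s t : ℝ} (has : a ≤ s) (hst : s ≤ t) :
    (∫⁻ x in Icc a s, K x) + ∫⁻ x in Icc s t, K x = ∫⁻ x in Icc a t, K x := by
  rw [← restrict_Ioc_eq_restrict_Icc (a := s) (b := t),
    ← lintegral_union measurableSet_Ioc, Icc_union_Ioc_eq_Icc has hst]
  rw [Set.disjoint_left]
  intro x hx hx'
  exact absurd hx.2 (not_le.2 hx'.1)

/-- An increment estimate on short intervals extends to the whole interval. -/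
theorem edist_le_lintegral_of_short {w : ℝ → ℝ} {K : ℝ → ℝ≥0∞} {a b δ : ℝ} (hab : a ≤ b)
    (hδ : 0 < δ)
    (h : ∀ s t, a ≤ s → s ≤ t → t ≤ b → t - s ≤ δ → edist (w s) (w t) ≤ ∫⁻ x in Icc s t, K x) :
    edist (w a) (w b) ≤ ∫⁻ x in Icc a b, K x := by
  have key : ∀ n : ℕ, ∀ t, a ≤ t → t ≤ b → t - a ≤ n * δ →
      edist (w a) (w t) ≤ ∫⁻ x in Icc a t, K x := by
    intro n
    induction n with
    | zero =>
      intro t hat htb hn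
      have : t = a := by simp at hn; linarith
      simp [this]
    | succ n ih =>
      intro t hat htb hn
      push_cast at hn
      have h1 : a ≤ max a (t - δ) := le_max_left _ _
      have h2 : max a (t - δ) ≤ t := max_le hat (by linarith)
      calc edist (w a) (w t) ≤ edist (w a) (w (max a (t - δ))) + edist (w (max a (t - δ))) (w t) :=
            edist_triangle _ _ _
        _ ≤ (∫⁻ x in Icc a (max a (t - δ)), K x) + ∫⁻ x in Icc (max a (t - δ)) t, K x := by
            gcongr
            · refine ih _ h1 (h2.trans htb) ?_
              rw [sub_le_iff_le_add]
              refine max_le ?_ ?_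
              · have : 0 ≤ (n : ℝ) * δ := by positivity
                linarith
              · linarith
            · refine h _ _ h1 h2 htb ?_
              have := le_max_right a (t - δ)
              linarith
        _ = _ := lintegral_Icc_add_lintegral_Icc h1 h2
  obtain ⟨n, hn⟩ := exists_nat_ge ((b - a) / δ)
  exact key n b hab le_rfl (by rwa [div_le_iff₀ hδ] at hn)

/-- The rule that underlies the product and the chain rule for upper gradients. -/
theorem edist_le_lintegral_mul_add_mul {w : ℝ → ℝ} {α₁ α₂ : ℝ → ℝ≥0} {G₁ G₂ : ℝ → ℝ≥0∞} {a b : ℝ}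
    (hab : a ≤ b) (hα₁ : ContinuousOn α₁ (Icc a b)) (hα₂ : ContinuousOn α₂ (Icc a b))
    (hm₁ : AEMeasurable G₁ (volume.restrict (Icc a b)))
    (hm₂ : AEMeasurable G₂ (volume.restrict (Icc a b)))
    (hG₁ : ∫⁻ x in Icc a b, G₁ x ≠ ∞) (hG₂ : ∫⁻ x in Icc a b, G₂ x ≠ ∞)
    (h : ∀ s t, a ≤ s → s ≤ t → t ≤ b → ∃ σ₁ ∈ Icc s t, ∃ σ₂ ∈ Icc s t,
      edist (w s) (w t) ≤
        α₁ σ₁ * (∫⁻ x in Icc s t, G₁ x) + α₂ σ₂ * ∫⁻ x in Icc s t, G₂ x) :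
    edist (w a) (w b) ≤ ∫⁻ x in Icc a b, (α₁ x * G₁ x + α₂ x * G₂ x) := by
  have hfin : (∫⁻ x in Icc a b, (G₁ x + G₂ x)) ≠ ∞ := by
    rw [lintegral_add_left' hm₁]
    exact ENNReal.add_ne_top.2 ⟨hG₁, hG₂⟩
  -- On short intervals uniform continuity replaces `αᵢ σᵢ` by `αᵢ x + ε` for every `x`. The total
  -- error is `ε * ∫ (G₁ + G₂)`, which is negligible because both integrals are finite.
  have key : ∀ ε : ℝ≥0, 0 < ε → edist (w a) (w b) ≤
      (∫⁻ x in Icc a b, (α₁ x * G₁ x + α₂ x * G₂ x)) + ε * ∫⁻ x in Icc a b, (G₁ x + G₂ x) := by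
    intro ε hε
    have hu₁ := isCompact_Icc.uniformContinuousOn_of_continuous hα₁
    have hu₂ := isCompact_Icc.uniformContinuousOn_of_continuous hα₂
    rw [Metric.uniformContinuousOn_iff] at hu₁ hu₂
    obtain ⟨δ₁, hδ₁, H₁⟩ := hu₁ ε (by exact_mod_cast hε)
    obtain ⟨δ₂, hδ₂, H₂⟩ := hu₂ ε (by exact_mod_cast hε)
    have hle : ∀ (α : ℝ → ℝ≥0) (σ x : ℝ), dist (α σ) (α x) < ε → α σ ≤ α x + ε := by
      intro α σ x hd
      rw [NNReal.dist_eq, abs_lt] at hd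
      have : (α σ : ℝ) ≤ α x + ε := by linarith
      exact_mod_cast this
    rw [← lintegral_const_mul' _ _ ENNReal.coe_ne_top]
    have hmul : AEMeasurable (fun x => (ε : ℝ≥0∞) * (G₁ x + G₂ x))
      (volume.restrict (Icc a b)) := (hm₁.add hm₂).const_mul _
    rw [← lintegral_add_right' _ hmul]
    refine edist_le_lintegral_of_short hab (δ := min δ₁ δ₂ / 2) (by positivity) ?_
    intro s t has hst htb hd
    have hm : min δ₁ δ₂ / 2 < min δ₁ δ₂ := half_lt_self (by positivity)
    have hclose : ∀ σ ∈ Icc s t, ∀ x ∈ Icc s t, dist σ x < min δ₁ δ₂ := by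
      intro σ hσ x hx
      rw [Real.dist_eq, abs_lt]
      constructor <;> linarith [hσ.1, hσ.2, hx.1, hx.2]
    have hsub : Icc s t ⊆ Icc a b := Icc_subset_Icc has htb
    obtain ⟨σ₁, hσ₁, σ₂, hσ₂, hw⟩ := h s t has hst htb
    refine hw.trans ?_
    rw [← lintegral_const_mul' _ _ ENNReal.coe_ne_top, ← lintegral_const_mul' _ _ ENNReal.coe_ne_top]
    refine (le_lintegral_add _ _).trans ?_
    refine setLIntegral_mono' measurableSet_Icc fun x hx => ?_
    have e₁ := hle α₁ σ₁ x
      (H₁ _ (hsub hσ₁) _ (hsub hx) ((hclose _ hσ₁ _ hx).trans_le (min_le_left _ _)))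
    have e₂ := hle α₂ σ₂ x
      (H₂ _ (hsub hσ₂) _ (hsub hx) ((hclose _ hσ₂ _ hx).trans_le (min_le_right _ _)))
    calc (α₁ σ₁ : ℝ≥0∞) * G₁ x + α₂ σ₂ * G₂ x
        ≤ ((α₁ x + ε : ℝ≥0) : ℝ≥0∞) * G₁ x + ((α₂ x + ε : ℝ≥0) : ℝ≥0∞) * G₂ x := by gcongr
      _ = _ := by push_cast; ring
  refine ENNReal.le_of_forall_pos_le_add fun η hη _ => ?_
  set T := ∫⁻ x in Icc a b, (G₁ x + G₂ x)
  have hT : (T.toNNReal : ℝ≥0∞) = T := ENNReal.coe_toNNReal hfin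
  refine (key (η / (T.toNNReal + 1)) (by positivity)).trans ?_
  gcongr
  rw [← hT]
  norm_cast
  rw [div_mul_eq_mul_div]
  refine div_le_of_le_mul₀ (by positivity) (by positivity) ?_
  gcongr
  simp

/-- It is enough to check the increment estimate on the intervals without zeros. -/
theorem edist_le_lintegral_of_ne_zero {w : ℝ → ℝ} {K : ℝ → ℝ≥0∞} {a b : ℝ} (hab : a ≤ b)
    (hw : ContinuousOn w (Icc a b))
    (h : ∀ s t, a ≤ s → s ≤ t → t ≤ b → (∀ x ∈ Icc s t, w x ≠ 0) →
      edist (w s) (w t) ≤ ∫⁻ x in Icc s t, K x) :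
    edist (w a) (w b) ≤ ∫⁻ x in Icc a b, K x := by
  by_cases hz : ∃ x ∈ Icc a b, w x = 0
  swap
  · push Not at hz
    exact h a b le_rfl hab le_rfl hz
  have hZ : IsCompact (Icc a b ∩ w ⁻¹' {0}) :=
    isCompact_Icc.of_isClosed_subset (hw.preimage_isClosed_of_isClosed isClosed_Icc
      isClosed_singleton) inter_subset_left
  have hne : (Icc a b ∩ w ⁻¹' {0}).Nonempty := by
    obtain ⟨x, hx, hx0⟩ := hz
    exact ⟨x, hx, hx0⟩
  -- Here `s` is the first zero and `t` the last. Between them `w` has no net increment, and outside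
  -- there are no zeros, so the hypothesis applies up to a limit at `s` and at `t`.
  obtain ⟨s, ⟨hs, hs0⟩, hsl⟩ := hZ.exists_isLeast hne
  obtain ⟨t, ⟨ht, ht0⟩, htg⟩ := hZ.exists_isGreatest hne
  have hst : s ≤ t := htg ⟨hs, hs0⟩
  simp only [mem_preimage, mem_singleton_iff] at hs0 ht0
  have h1 : edist (w a) (w s) ≤ ∫⁻ x in Icc a s, K x := by
    rcases hs.1.eq_or_lt with rfl | has
    · simp
    have hlim : Tendsto (fun x => edist (w a) (w x)) (𝓝[Ico a s] s) (𝓝 (edist (w a) (w s))) :=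
      tendsto_const_nhds.edist ((hw s hs).mono (Ico_subset_Icc_self.trans
        (Icc_subset_Icc le_rfl hs.2)))
    have : (𝓝[Ico a s] s).NeBot := right_nhdsWithin_Ico_neBot has
    refine le_of_tendsto hlim ?_
    filter_upwards [self_mem_nhdsWithin] with x hx
    refine (h a x le_rfl hx.1 (hx.2.le.trans hs.2) ?_).trans
      (lintegral_mono_set (Icc_subset_Icc le_rfl hx.2.le))
    intro y hy hy0
    exact absurd (hsl ⟨⟨hy.1, hy.2.trans (hx.2.le.trans hs.2)⟩, hy0⟩)
      (not_le.2 (hy.2.trans_lt hx.2))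
  have h2 : edist (w t) (w b) ≤ ∫⁻ x in Icc t b, K x := by
    rcases ht.2.eq_or_lt with rfl | htb
    · simp
    have hlim : Tendsto (fun x => edist (w x) (w b)) (𝓝[Ioc t b] t) (𝓝 (edist (w t) (w b))) :=
      Tendsto.edist ((hw t ht).mono (Ioc_subset_Icc_self.trans
        (Icc_subset_Icc ht.1 le_rfl))) tendsto_const_nhds
    have : (𝓝[Ioc t b] t).NeBot := left_nhdsWithin_Ioc_neBot htb
    refine le_of_tendsto hlim ?_
    filter_upwards [self_mem_nhdsWithin] with x hx
    refine (h x b (ht.1.trans hx.1.le) hx.2 le_rfl ?_).trans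
      (lintegral_mono_set (Icc_subset_Icc hx.1.le le_rfl))
    intro y hy hy0
    exact absurd (htg ⟨⟨ht.1.trans (hx.1.le.trans hy.1), hy.2⟩, hy0⟩)
      (not_le.2 (hx.1.trans_le hy.1))
  rw [hs0] at h1
  rw [ht0] at h2
  calc edist (w a) (w b) ≤ edist (w a) 0 + edist 0 (w b) := edist_triangle _ _ _
    _ ≤ (∫⁻ x in Icc a s, K x) + ∫⁻ x in Icc t b, K x := add_le_add h1 h2
    _ ≤ (∫⁻ x in Icc a s, K x) + ∫⁻ x in Icc s b, K x := by
        gcongr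
    _ = _ := lintegral_Icc_add_lintegral_Icc hs.1 hs.2

variable {X : Type*} [MetricSpace X]

theorem HasUnitSpeedOn.edist_le {γ : ℝ → X} {S : Set ℝ} (hγ : HasUnitSpeedOn γ S) {s t : ℝ}
    (hs : s ∈ S) (ht : t ∈ S) (hst : s ≤ t) : edist (γ s) (γ t) ≤ ENNReal.ofReal (t - s) := by
  have h := hγ hs ht
  rw [NNReal.coe_one, one_mul] at h
  rw [← h]
  exact eVariationOn.edist_le γ ⟨hs, le_rfl, hst⟩ ⟨ht, hst, le_rfl⟩

theorem HasUnitSpeedOn.continuousOn {γ : ℝ → X} {S : Set ℝ} (hγ : HasUnitSpeedOn γ S) :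
    ContinuousOn γ S := by
  have : LipschitzOnWith 1 γ S := by
    intro s hs t ht
    rw [ENNReal.coe_one, one_mul]
    rcases le_total s t with h | h
    · refine (hγ.edist_le hs ht h).trans ?_
      rw [edist_dist, dist_comm, Real.dist_eq]
      exact ENNReal.ofReal_le_ofReal (le_abs_self _)
    · rw [edist_comm]
      refine (hγ.edist_le ht hs h).trans ?_
      rw [edist_dist, Real.dist_eq]
      exact ENNReal.ofReal_le_ofReal (le_abs_self _)
  exact this.continuousOn

theorem HasUnitSpeedOn.translate {γ : ℝ → X} {l a b : ℝ} (hγ : HasUnitSpeedOn γ (Icc 0 l))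
    (ha : 0 ≤ a) (hb : b ≤ l) : HasUnitSpeedOn (fun t => γ (a + t)) (Icc 0 (b - a)) := by
  intro s hs t ht
  have hsub : ∀ {x}, x ∈ Icc 0 (b - a) → a + x ∈ Icc 0 l := fun {x} hx =>
    ⟨by linarith [hx.1], by linarith [hx.2]⟩
  have h := hγ (hsub hs) (hsub ht)
  rw [add_sub_add_left_eq_sub] at h
  rw [← h]
  have hmono : MonotoneOn (fun x : ℝ => a + x) (Icc 0 (b - a) ∩ Icc s t) :=
    fun x _ y _ hxy => by simpa using hxy
  have := eVariationOn.comp_eq_of_monotoneOn γ (fun x : ℝ => a + x) hmono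
  refine Eq.trans this ?_
  congr 1
  ext x
  simp only [mem_image, mem_inter_iff, mem_Icc]
  constructor
  · rintro ⟨y, ⟨⟨h1, h2⟩, h3, h4⟩, rfl⟩
    exact ⟨⟨by linarith, by linarith⟩, by linarith, by linarith⟩
  · rintro ⟨⟨h1, h2⟩, h3, h4⟩
    exact ⟨x - a, ⟨⟨by linarith [hs.1], by linarith [ht.2]⟩, by linarith, by linarith⟩, by ring⟩

theorem lintegral_Icc_translate (K : ℝ → ℝ≥0∞) (a b : ℝ) :
    ∫⁻ t in Icc 0 (b - a), K (a + t) = ∫⁻ t in Icc a b, K t := by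
  rw [← lintegral_indicator measurableSet_Icc, ← lintegral_indicator measurableSet_Icc,
    ← lintegral_add_left_eq_self ((Icc a b).indicator K) a]
  congr 1
  ext t
  simp only [indicator, mem_Icc]
  congr 1
  simp only [eq_iff_iff]
  constructor <;> rintro ⟨h1, h2⟩ <;> constructor <;> linarith

variable [MeasurableSpace X]

/-- Subarcs of a unit speed curve are again admissible after a translation of the parameter. Only
the subarc has to lie in `A`. -/
theorem IsUpperGradientOn.edist_le_lintegral_Icc {g : X → ℝ≥0∞} {f : X → ℝ} {A : Set X}
    (hg : IsUpperGradientOn g f A) {l a b : ℝ} {γ : ℝ → X} (hγ : HasUnitSpeedOn γ (Icc 0 l))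
    (hA : MapsTo γ (Icc a b) A) (ha : 0 ≤ a) (hab : a ≤ b) (hb : b ≤ l) :
    edist (f (γ a)) (f (γ b)) ≤ ∫⁻ t in Icc a b, g (γ t) := by
  have h := hg.2 (b - a) (fun t => γ (a + t)) (by linarith) (hγ.translate ha hb)
    (fun t ht => hA ⟨by linarith [ht.1], by linarith [ht.2]⟩)
  rw [lintegral_Icc_translate (fun t => g (γ t))] at h
  simpa using h

theorem aemeasurable_comp_curve [BorelSpace X] {g : X → ℝ≥0∞} (hg : Measurable g) {γ : ℝ → X}
    {S : Set ℝ} (hS : MeasurableSet S) (hγ : ContinuousOn γ S) :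
    AEMeasurable (fun t => g (γ t)) (volume.restrict S) :=
  hg.comp_aemeasurable (hγ.aemeasurable hS)

/-- For a continuous function it is enough to test upper gradients on the curves along which
the function does not vanish. -/
theorem isUpperGradientOn_univ_of_ne_zero {v : X → ℝ} {h : X → ℝ≥0∞} (hv : Continuous v)
    (hh : Measurable h)
    (H : ∀ (l : ℝ) (γ : ℝ → X), 0 ≤ l → HasUnitSpeedOn γ (Icc 0 l) →
      (∀ t ∈ Icc 0 l, v (γ t) ≠ 0) → edist (v (γ 0)) (v (γ l)) ≤ ∫⁻ t in Icc 0 l, h (γ t)) :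
    IsUpperGradientOn h v univ := by
  refine ⟨hh, fun l γ hl hγ _ => ?_⟩
  refine edist_le_lintegral_of_ne_zero (w := fun t => v (γ t)) hl
    (hv.comp_continuousOn hγ.continuousOn) ?_
  intro s t hs hst htl hne
  have := H (t - s) (fun x => γ (s + x)) (by linarith) (hγ.translate hs htl)
    (fun x hx => hne _ ⟨by linarith [hx.1], by linarith [hx.2]⟩)
  rw [lintegral_Icc_translate (fun t => h (γ t))] at this
  simpa using this

/-- The Poincaré inequality sees the upper gradient on `E` as well, while the Hardy inequality
integrates only over `Eᶜ`. For a function vanishing near `E` this truncation removes the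
discrepancy. -/
theorem IsUpperGradientOn.indicator_ne_zero [BorelSpace X] {v : X → ℝ} {h : X → ℝ≥0∞}
    (hv : Continuous v) (hh : IsUpperGradientOn h v univ) :
    IsUpperGradientOn ({x | v x ≠ 0}.indicator h) v univ := by
  refine isUpperGradientOn_univ_of_ne_zero hv
    (hh.1.indicator (isOpen_ne_fun hv continuous_const).measurableSet) ?_
  intro l γ hl hγ hne
  refine (hh.2 l γ hl hγ (mapsTo_univ _ _)).trans (le_of_eq ?_)
  refine setLIntegral_congr_fun measurableSet_Icc fun t ht => ?_
  exact (indicator_of_mem (s := {x | v x ≠ 0}) (hne t ht) h).symm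

end Curves

/-! ### Chain rule, product rule and cutoffs for upper gradients -/

section UpperGradientCalculus

open Filter Topology

/-- Mean value theorem. The derivative is monotone, increasing or decreasing according to whether `1
≤ a`, so its supremum is attained at an endpoint. -/
theorem abs_rpow_sub_rpow_le {a x y : ℝ} (ha : 0 ≤ a) (hx : 0 < x) (hy : 0 < y) :
    |x ^ a - y ^ a| ≤ a * max (x ^ (a - 1)) (y ^ (a - 1)) * |x - y| := by
  have hpos : ∀ z ∈ uIcc y x, 0 < z := fun z hz => (lt_min hy hx).trans_le hz.1
  have h := Convex.norm_image_sub_le_of_norm_hasDerivWithin_le (f := fun z : ℝ => z ^ a)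
    (f' := fun z => a * z ^ (a - 1)) (C := a * max (x ^ (a - 1)) (y ^ (a - 1))) (s := uIcc y x)
    (x := y) (y := x)
    (fun z hz => (Real.hasDerivAt_rpow_const (Or.inl (hpos z hz).ne')).hasDerivWithinAt)
    (fun z hz => ?_) (convex_uIcc y x) left_mem_uIcc right_mem_uIcc
  · simpa using h
  · have hz0 := hpos z hz
    rw [Real.norm_of_nonneg (by positivity)]
    gcongr
    rcases le_total 1 a with h1 | h1
    · rcases le_total x y with hxy | hxy
      · rw [uIcc_of_ge hxy] at hz
        exact le_max_of_le_right (Real.rpow_le_rpow hz0.le hz.2 (by linarith))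
      · rw [uIcc_of_le hxy] at hz
        exact le_max_of_le_left (Real.rpow_le_rpow hz0.le hz.2 (by linarith))
    · rcases le_total x y with hxy | hxy
      · rw [uIcc_of_ge hxy] at hz
        exact le_max_of_le_left (Real.rpow_le_rpow_of_nonpos hx hz.1 (by linarith))
      · rw [uIcc_of_le hxy] at hz
        exact le_max_of_le_right (Real.rpow_le_rpow_of_nonpos hy hz.1 (by linarith))

theorem edist_rpow_le_lintegral {f : ℝ → ℝ} {G : ℝ → ℝ≥0∞} {a b p : ℝ} (hab : a ≤ b) (hp : 0 ≤ p)
    (hf : ContinuousOn f (Icc a b)) (hpos : ∀ x ∈ Icc a b, 0 < f x)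
    (hm : AEMeasurable G (volume.restrict (Icc a b))) (hG : ∫⁻ x in Icc a b, G x ≠ ∞)
    (h : ∀ s t, a ≤ s → s ≤ t → t ≤ b → edist (f s) (f t) ≤ ∫⁻ x in Icc s t, G x) :
    edist (f a ^ p) (f b ^ p) ≤ ∫⁻ x in Icc a b, ENNReal.ofReal (p * f x ^ (p - 1)) * G x := by
  have key := edist_le_lintegral_mul_add_mul (w := fun x => f x ^ p)
    (α₁ := fun x => (p * f x ^ (p - 1)).toNNReal) (α₂ := fun _ => 0) (G₁ := G) (G₂ := fun _ => 0)
    hab ?_ continuousOn_const hm aemeasurable_const hG (by simp) ?_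
  · simpa [ENNReal.ofReal] using key
  · refine continuous_real_toNNReal.comp_continuousOn (continuousOn_const.mul
      (hf.rpow_const fun x hx => Or.inl (hpos x hx).ne'))
  · intro s t has hst htb
    have hs0 := hpos s ⟨has, hst.trans htb⟩
    have ht0 := hpos t ⟨has.trans hst, htb⟩
    have hle := abs_rpow_sub_rpow_le hp hs0 ht0
    obtain ⟨σ, hσ, hmax⟩ : ∃ σ ∈ Icc s t,
        max (f s ^ (p - 1)) (f t ^ (p - 1)) = f σ ^ (p - 1) := by
      rcases max_choice (f s ^ (p - 1)) (f t ^ (p - 1)) with h | h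
      · exact ⟨s, ⟨le_rfl, hst⟩, h⟩
      · exact ⟨t, ⟨hst, le_rfl⟩, h⟩
    refine ⟨σ, hσ, σ, hσ, ?_⟩
    have hσ0 := hpos σ ⟨has.trans hσ.1, hσ.2.trans htb⟩
    rw [hmax] at hle
    rw [ENNReal.coe_zero, zero_mul, add_zero]
    calc edist (f s ^ p) (f t ^ p) = ENNReal.ofReal |f s ^ p - f t ^ p| := by
          rw [edist_dist, Real.dist_eq]
      _ ≤ ENNReal.ofReal (p * f σ ^ (p - 1) * |f s - f t|) := ENNReal.ofReal_le_ofReal hle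
      _ = ENNReal.ofReal (p * f σ ^ (p - 1)) * edist (f s) (f t) := by
          rw [ENNReal.ofReal_mul (by positivity), edist_dist, Real.dist_eq]
      _ ≤ _ := by
          gcongr
          · exact le_rfl
          · exact h s t has hst htb

/-- In `η s * (f s - f t) + f t * (η s - η t)` the two coefficients are taken at different points;
this is why `edist_le_lintegral_mul_add_mul` allows separate `σ₁` and `σ₂`. -/
theorem edist_mul_le_lintegral {f η : ℝ → ℝ} {G₁ G₂ : ℝ → ℝ≥0∞} {a b : ℝ} (hab : a ≤ b)
    (hf : ContinuousOn f (Icc a b)) (hη : ContinuousOn η (Icc a b))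
    (hm₁ : AEMeasurable G₁ (volume.restrict (Icc a b)))
    (hm₂ : AEMeasurable G₂ (volume.restrict (Icc a b)))
    (hG₁ : ∫⁻ x in Icc a b, G₁ x ≠ ∞) (hG₂ : ∫⁻ x in Icc a b, G₂ x ≠ ∞)
    (h₁ : ∀ s t, a ≤ s → s ≤ t → t ≤ b → edist (f s) (f t) ≤ ∫⁻ x in Icc s t, G₁ x)
    (h₂ : ∀ s t, a ≤ s → s ≤ t → t ≤ b → edist (η s) (η t) ≤ ∫⁻ x in Icc s t, G₂ x) :
    edist (f a * η a) (f b * η b) ≤ ∫⁻ x in Icc a b, (‖η x‖ₑ * G₁ x + ‖f x‖ₑ * G₂ x) := by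
  refine edist_le_lintegral_mul_add_mul (w := fun x => f x * η x)
    (α₁ := fun x => ‖η x‖₊) (α₂ := fun x => ‖f x‖₊) hab hη.nnnorm hf.nnnorm hm₁ hm₂ hG₁ hG₂ ?_
  intro s t has hst htb
  refine ⟨s, ⟨le_rfl, hst⟩, t, ⟨hst, le_rfl⟩, ?_⟩
  calc edist (f s * η s) (f t * η t) = ‖η s * (f s - f t) + f t * (η s - η t)‖ₑ := by
        rw [edist_eq_enorm_sub]; congr 1; ring
    _ ≤ ‖η s * (f s - f t)‖ₑ + ‖f t * (η s - η t)‖ₑ := enorm_add_le _ _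
    _ = ‖η s‖ₑ * edist (f s) (f t) + ‖f t‖ₑ * edist (η s) (η t) := by
        rw [enorm_mul, enorm_mul, edist_eq_enorm_sub, edist_eq_enorm_sub]
    _ ≤ _ := by
        gcongr
        · exact le_rfl
        · exact h₁ s t has hst htb
        · exact le_rfl
        · exact h₂ s t has hst htb

theorem HasUnitSpeedOn.edist_lipschitz_le {X : Type*} [MetricSpace X] {d : X → ℝ}
    (hd : LipschitzWith 1 d) {γ : ℝ → X} {l : ℝ}
    (hγ : HasUnitSpeedOn γ (Icc 0 l)) {s t : ℝ} (hs : 0 ≤ s) (hst : s ≤ t) (ht : t ≤ l) :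
    edist (d (γ s)) (d (γ t)) ≤ ENNReal.ofReal (t - s) := by
  have h := hd (γ s) (γ t)
  rw [ENNReal.coe_one, one_mul] at h
  exact h.trans (hγ.edist_le ⟨hs, hst.trans ht⟩ ⟨hs.trans hst, ht⟩ hst)

section Cutoff

variable {X : Type*}

/-- A cutoff function which vanishes where `d ≤ ε` and equals `1` where `2 * ε ≤ d`. -/
noncomputable def distCutoff (d : X → ℝ) (ε : ℝ) (x : X) : ℝ := min 1 (max 0 (d x / ε - 1))

theorem continuous_distCutoff [TopologicalSpace X] {d : X → ℝ} (hd : Continuous d) (ε : ℝ) :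
    Continuous (distCutoff d ε) :=
  continuous_const.min (continuous_const.max ((hd.div_const ε).sub continuous_const))

theorem distCutoff_nonneg (d : X → ℝ) (ε : ℝ) (x : X) : 0 ≤ distCutoff d ε x :=
  le_min zero_le_one (le_max_left _ _)

theorem distCutoff_le_one (d : X → ℝ) (ε : ℝ) (x : X) : distCutoff d ε x ≤ 1 := min_le_left _ _

theorem distCutoff_eq_zero {d : X → ℝ} {ε : ℝ} (hε : 0 < ε) {x : X} (hx : d x ≤ ε) :
    distCutoff d ε x = 0 := by
  have : d x / ε ≤ 1 := (div_le_one hε).2 hx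
  rw [distCutoff, max_eq_left (by linarith), min_eq_right zero_le_one]

theorem distCutoff_eq_one {d : X → ℝ} {ε : ℝ} (hε : 0 < ε) {x : X} (hx : 2 * ε ≤ d x) :
    distCutoff d ε x = 1 := by
  have : 2 ≤ d x / ε := (le_div_iff₀ hε).2 hx
  rw [distCutoff, max_eq_right (by linarith), min_eq_left (by linarith)]

theorem edist_distCutoff_le (d : X → ℝ) {ε : ℝ} (hε : 0 < ε) (x y : X) :
    edist (distCutoff d ε x) (distCutoff d ε y) ≤ ENNReal.ofReal ε⁻¹ * edist (d x) (d y) := by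
  rw [edist_dist, edist_dist, ← ENNReal.ofReal_mul (by positivity), Real.dist_eq, Real.dist_eq]
  refine ENNReal.ofReal_le_ofReal ?_
  calc |distCutoff d ε x - distCutoff d ε y|
      ≤ |max 0 (d x / ε - 1) - max 0 (d y / ε - 1)| := by
        simpa [distCutoff] using abs_min_sub_min_le_max 1 (max 0 (d x / ε - 1)) 1 (max 0 (d y / ε - 1))
    _ ≤ |(d x / ε - 1) - (d y / ε - 1)| := by
        simpa using abs_max_sub_max_le_max 0 (d x / ε - 1) 0 (d y / ε - 1)
    _ = ε⁻¹ * |d x - d y| := by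
        rw [show d x / ε - 1 - (d y / ε - 1) = ε⁻¹ * (d x - d y) by ring, abs_mul,
          abs_of_pos (inv_pos.2 hε)]

end Cutoff

variable {X : Type*} [MetricSpace X] [MeasurableSpace X] [BorelSpace X]

/-- A weight that is continuous and positive along a curve does not affect finiteness of the
integral along the curve. -/
theorem lintegral_ne_top_of_mul {c : ℝ → ℝ} {G : ℝ → ℝ≥0∞} {a b : ℝ} (hab : a ≤ b)
    (hc : ContinuousOn c (Icc a b)) (hpos : ∀ x ∈ Icc a b, 0 < c x)
    (h : ∫⁻ x in Icc a b, ENNReal.ofReal (c x) * G x ≠ ∞) : ∫⁻ x in Icc a b, G x ≠ ∞ := by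
  obtain ⟨x₀, hx₀, hmin⟩ := isCompact_Icc.exists_isMinOn (nonempty_Icc.2 hab) hc
  have h0 := hpos x₀ hx₀
  intro htop
  refine h (top_le_iff.1 ?_)
  calc ∞ = ENNReal.ofReal (c x₀) * ∫⁻ x in Icc a b, G x := by
        rw [htop, ENNReal.mul_top (by simpa using h0)]
    _ = ∫⁻ x in Icc a b, ENNReal.ofReal (c x₀) * G x :=
        (lintegral_const_mul' _ _ ENNReal.ofReal_ne_top).symm
    _ ≤ _ := setLIntegral_mono' measurableSet_Icc fun x hx => by
        gcongr
        exact hmin hx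

/-- Chain rule for `|v| ^ a`. -/
theorem IsUpperGradientOn.abs_rpow {v : X → ℝ} {h : X → ℝ≥0∞} (hv : Continuous v)
    (hh : IsUpperGradientOn h v univ) {a : ℝ} (ha : 1 ≤ a) :
    IsUpperGradientOn (fun x => ENNReal.ofReal (a * |v x| ^ (a - 1)) * h x)
      (fun x => |v x| ^ a) univ := by
  have hc : Continuous fun x => |v x| := hv.abs
  refine isUpperGradientOn_univ_of_ne_zero (hc.rpow_const fun x => Or.inr (by linarith)) ?_ ?_
  · refine Measurable.mul ?_ hh.1
    exact ENNReal.measurable_ofReal.comp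
      (continuous_const.mul (hc.rpow_const fun x => Or.inr (by linarith))).measurable
  · intro l γ hl hγ hne
    have hγc := hγ.continuousOn
    have hpos : ∀ t ∈ Icc 0 l, 0 < |v (γ t)| := by
      intro t ht
      rcases (abs_nonneg (v (γ t))).eq_or_lt with h0 | h0
      · exact absurd (by rw [← h0, Real.zero_rpow (by linarith)]) (hne t ht)
      · exact h0
    by_cases hfin : ∫⁻ t in Icc 0 l, ENNReal.ofReal (a * |v (γ t)| ^ (a - 1)) * h (γ t) = ∞
    · simp only [hfin, le_top]
    refine edist_rpow_le_lintegral (f := fun t => |v (γ t)|) hl (by linarith)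
      (hc.comp_continuousOn hγc) hpos (aemeasurable_comp_curve hh.1 measurableSet_Icc hγc)
      (lintegral_ne_top_of_mul (c := fun t => a * |v (γ t)| ^ (a - 1)) hl ?_ ?_ hfin) ?_
    · exact continuousOn_const.mul ((hc.comp_continuousOn hγc).rpow_const
        fun t ht => Or.inl (hpos t ht).ne')
    · intro t ht
      have := hpos t ht
      positivity
    · intro s t hs hst ht
      refine le_trans ?_ (hh.edist_le_lintegral_Icc hγ (mapsTo_univ _ _) hs hst ht)
      rw [edist_dist, edist_dist, Real.dist_eq, Real.dist_eq]
      exact ENNReal.ofReal_le_ofReal (abs_abs_sub_abs_le_abs_sub _ _)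

/-- Product rule for `v * d ^ θ`, where `d` is `1`-Lipschitz. -/
theorem IsUpperGradientOn.mul_rpow {v d : X → ℝ} {h : X → ℝ≥0∞} (hv : Continuous v)
    (hh : IsUpperGradientOn h v univ) (hd : LipschitzWith 1 d) (hd0 : ∀ x, 0 ≤ d x) {θ : ℝ}
    (hθ : 0 < θ) :
    IsUpperGradientOn (fun x => ENNReal.ofReal (d x ^ θ) * h x
        + ‖v x‖ₑ * ENNReal.ofReal (θ * d x ^ (θ - 1)))
      (fun x => v x * d x ^ θ) univ := by
  have hdc : Continuous fun x => d x ^ θ := hd.continuous.rpow_const fun x => Or.inr hθ.le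
  refine isUpperGradientOn_univ_of_ne_zero (hv.mul hdc) ?_ ?_
  · refine ((ENNReal.measurable_ofReal.comp hdc.measurable).mul hh.1).add
      (hv.measurable.enorm.mul (ENNReal.measurable_ofReal.comp ?_))
    exact measurable_const.mul (hd.continuous.measurable.pow_const _)
  · intro l γ hl hγ hne
    have hγc := hγ.continuousOn
    -- Along a curve without zeros of `v * d ^ θ` the distance stays positive, so `d ^ (θ - 1)` is
    -- continuous there even when `θ < 1`.
    have hpos : ∀ t ∈ Icc 0 l, 0 < d (γ t) := by
      intro t ht
      rcases (hd0 (γ t)).eq_or_lt with h0 | h0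
      · exact absurd (by rw [← h0, Real.zero_rpow hθ.ne', mul_zero]) (hne t ht)
      · exact h0
    by_cases hfin : ∫⁻ t in Icc 0 l, ENNReal.ofReal (d (γ t) ^ θ) * h (γ t) = ∞
    · refine le_trans le_top (top_le_iff.2 (top_le_iff.1 (hfin.symm.le.trans ?_))).ge
      exact lintegral_mono fun t => le_self_add
    have hcd : ContinuousOn (fun t => d (γ t)) (Icc 0 l) := hd.continuous.comp_continuousOn hγc
    have hcd' : ∀ e : ℝ, ContinuousOn (fun t => d (γ t) ^ e) (Icc 0 l) := fun e =>
      hcd.rpow_const fun t ht => Or.inl (hpos t ht).ne'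
    have hG : ∀ s t, 0 ≤ s → t ≤ l →
        ∫⁻ x in Icc s t, ENNReal.ofReal (θ * d (γ x) ^ (θ - 1)) ≠ ∞ := by
      intro s t hs ht
      have hsub : Icc s t ⊆ Icc 0 l := Icc_subset_Icc hs ht
      have hint : IntegrableOn (fun t => θ * d (γ t) ^ (θ - 1)) (Icc s t) :=
        ((continuousOn_const.mul (hcd' _)).mono hsub).integrableOn_Icc
      exact (hint.lintegral_lt_top).ne
    have key := edist_mul_le_lintegral (f := fun t => v (γ t)) (η := fun t => d (γ t) ^ θ)
      (G₁ := fun t => h (γ t)) (G₂ := fun t => ENNReal.ofReal (θ * d (γ t) ^ (θ - 1))) hl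
      (hv.comp_continuousOn hγc) (hcd' θ)
      (aemeasurable_comp_curve hh.1 measurableSet_Icc hγc) ?_
      (lintegral_ne_top_of_mul (c := fun t => d (γ t) ^ θ) hl (hcd' θ)
        (fun t ht => Real.rpow_pos_of_pos (hpos t ht) _) hfin)
      (hG 0 l le_rfl le_rfl)
      (fun s t hs hst ht => hh.edist_le_lintegral_Icc hγ (mapsTo_univ _ _) hs hst ht)
      ?_
    · refine key.trans (le_of_eq (lintegral_congr fun t => ?_))
      rw [Real.enorm_of_nonneg (Real.rpow_nonneg (hd0 _) _)]
    · exact (ENNReal.measurable_ofReal.comp_aemeasurable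
        ((continuousOn_const.mul (hcd' _)).aemeasurable measurableSet_Icc))
    · intro s t hs hst ht
      have hsub : Icc s t ⊆ Icc 0 l := Icc_subset_Icc hs ht
      have := edist_rpow_le_lintegral (f := fun t => d (γ t)) (G := fun _ => 1) hst hθ.le
        (hcd.mono hsub) (fun x hx => hpos x (hsub hx)) aemeasurable_const (by simp) ?_
      · simpa using this
      · intro s' t' hs' hst' ht'
        simpa using hγ.edist_lipschitz_le hd (hs.trans hs') hst' (ht'.trans ht)

/-- An upper gradient in an open set `{0 < d}` gives one on the whole space after a cutoff. -/
theorem IsUpperGradientOn.mul_distCutoff {u d : X → ℝ} {g : X → ℝ≥0∞} {Ω : Set X}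
    (hg : IsUpperGradientOn g u Ω) (hu : ContinuousOn u Ω) (hd : LipschitzWith 1 d)
    (hΩ : ∀ x, 0 < d x → x ∈ Ω) (hum : Measurable u) {ε : ℝ} (hε : 0 < ε)
    (hw : Continuous fun x => u x * distCutoff d ε x) :
    IsUpperGradientOn
      (fun x => g x + ‖u x‖ₑ * {x | d x < 2 * ε}.indicator (fun _ => ENNReal.ofReal ε⁻¹) x)
      (fun x => u x * distCutoff d ε x) univ := by
  have hρ : Measurable ({x | d x < 2 * ε}.indicator (fun _ : X => ENNReal.ofReal ε⁻¹)) :=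
    measurable_const.indicator (isOpen_lt hd.continuous continuous_const).measurableSet
  refine isUpperGradientOn_univ_of_ne_zero hw (hg.1.add (hum.enorm.mul hρ)) ?_
  intro l γ hl hγ hne
  have hγc := hγ.continuousOn
  have hdγ : ∀ t ∈ Icc 0 l, γ t ∈ Ω := by
    intro t ht
    refine hΩ _ (hε.trans ?_)
    by_contra hcon
    exact hne t ht (by rw [distCutoff_eq_zero hε (not_lt.1 hcon), mul_zero])
  by_cases hfin : ∫⁻ t in Icc 0 l, g (γ t) = ∞
  · refine le_trans le_top (top_le_iff.2 (top_le_iff.1 (hfin.symm.le.trans ?_))).ge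
    exact lintegral_mono fun t => le_self_add
  have key := edist_mul_le_lintegral (f := fun t => u (γ t)) (η := fun t => distCutoff d ε (γ t))
      (G₁ := fun t => g (γ t))
      (G₂ := fun t => {x | d x < 2 * ε}.indicator (fun _ : X => ENNReal.ofReal ε⁻¹) (γ t)) hl
      (hu.comp hγc hdγ) ((continuous_distCutoff hd.continuous ε).comp_continuousOn hγc)
      (aemeasurable_comp_curve hg.1 measurableSet_Icc hγc)
      (aemeasurable_comp_curve hρ measurableSet_Icc hγc) hfin ?_
      (fun s t hs hst ht => hg.edist_le_lintegral_Icc hγ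
        (fun x hx => hdγ x ⟨hs.trans hx.1, hx.2.trans ht⟩) hs hst ht) ?_
  · refine key.trans (lintegral_mono fun t => ?_)
    gcongr
    calc ‖distCutoff d ε (γ t)‖ₑ * g (γ t) ≤ 1 * g (γ t) := by
          gcongr
          rw [Real.enorm_of_nonneg (distCutoff_nonneg _ _ _)]
          exact ENNReal.ofReal_le_one.2 (distCutoff_le_one _ _ _)
      _ = _ := one_mul _
  · have hle : ∫⁻ t in Icc 0 l, {x | d x < 2 * ε}.indicator (fun _ : X => ENNReal.ofReal ε⁻¹) (γ t)
        ≤ ∫⁻ _ in Icc 0 l, ENNReal.ofReal ε⁻¹ :=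
      lintegral_mono fun t => by simp only [indicator]; split_ifs <;> simp
    refine ne_top_of_le_ne_top ?_ hle
    rw [lintegral_const]
    exact ENNReal.mul_ne_top ENNReal.ofReal_ne_top (by simp)
  · intro s t hs hst ht
    have hsub : Icc s t ⊆ Icc 0 l := Icc_subset_Icc hs ht
    -- The reduction to intervals without zeros is applied to `1 - distCutoff`: where this is
    -- nonzero, `d < 2 * ε`. Thus the gradient of the cutoff lives only in the strip.
    have h1 := edist_le_lintegral_of_ne_zero (w := fun t => 1 - distCutoff d ε (γ t))
      (K := fun t => {x | d x < 2 * ε}.indicator (fun _ : X => ENNReal.ofReal ε⁻¹) (γ t)) hst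
      ((continuous_const.sub (continuous_distCutoff hd.continuous ε)).comp_continuousOn
        (hγc.mono hsub)) ?_
    · simpa only [edist_sub_left] using h1
    · intro s' t' hs' hst' ht' hne'
      rw [edist_sub_left]
      refine (edist_distCutoff_le d hε _ _).trans ?_
      calc ENNReal.ofReal ε⁻¹ * edist (d (γ s')) (d (γ t'))
          ≤ ENNReal.ofReal ε⁻¹ * ENNReal.ofReal (t' - s') := by
            gcongr
            exact hγ.edist_lipschitz_le hd (hs.trans hs') hst' (ht'.trans ht)
        _ = ∫⁻ _ in Icc s' t', ENNReal.ofReal ε⁻¹ := by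
            simp
        _ = _ := by
            refine setLIntegral_congr_fun measurableSet_Icc fun x hx => ?_
            have hmem : γ x ∈ {x | d x < 2 * ε} := by
              by_contra hcon
              exact hne' x hx (by rw [distCutoff_eq_one hε (not_lt.1 hcon), sub_self])
            exact (indicator_of_mem hmem (fun _ : X => ENNReal.ofReal ε⁻¹)).symm

end UpperGradientCalculus

/-! ### Consequences of doubling: separability, infinite mass, exchange of averages -/

section Doubling

open Filter Topology

variable {X : Type*} [MetricSpace X] [MeasurableSpace X] {μ : Measure X}

theorem sigmaFinite_of_measure_closedBall_lt_top
    (hball : ∀ (x : X) (r : ℝ), 0 < r → 0 < μ (closedBall x r) ∧ μ (closedBall x r) < ∞) :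
    SigmaFinite μ := by
  rcases isEmpty_or_nonempty X with hX | ⟨⟨x⟩⟩
  · exact ⟨⟨⟨fun _ => univ, fun _ => trivial, fun _ => by simp [Measure.eq_zero_of_isEmpty μ],
      eq_univ_of_forall fun x => (IsEmpty.false x).elim⟩⟩⟩
  · refine ⟨⟨⟨fun n => closedBall x (n + 1), fun _ => trivial,
      fun n => (hball x _ (by positivity)).2, ?_⟩⟩⟩
    rw [eq_univ_iff_forall]
    intro y
    obtain ⟨n, hn⟩ := exists_nat_ge (dist y x)
    exact mem_iUnion.2 ⟨n, by rw [mem_closedBall]; linarith⟩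

/-- A maximal `ε`-separated set is countable, since the balls of radius `ε / 2` around it are
disjoint with positive measure and `μ` is σ-finite. Second countability makes `dist x y ≤ R`
measurable for the product σ-algebra, as Tonelli's theorem requires. -/
theorem secondCountableTopology_of_measure_closedBall [BorelSpace X]
    (hball : ∀ (x : X) (r : ℝ), 0 < r → 0 < μ (closedBall x r) ∧ μ (closedBall x r) < ∞) :
    SecondCountableTopology X := by
  have := sigmaFinite_of_measure_closedBall_lt_top hball
  refine Metric.secondCountable_of_almost_dense_set fun ε hε => ?_
  obtain ⟨N, hN⟩ := zorn_subset {N : Set X | N.Pairwise fun x y => ε < dist x y} (by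
    intro c hc hchain
    refine ⟨⋃₀ c, ?_, fun s hs => subset_sUnion_of_mem hs⟩
    exact (pairwise_sUnion hchain.directedOn).2 fun s hs => hc hs)
  refine ⟨N, ?_, ?_⟩
  · have hdisj : Pairwise (Function.onFun Disjoint fun x : N => closedBall (x : X) (ε / 2)) := by
      intro x y hxy
      have h1 : ε < dist (x : X) y := hN.prop x.2 y.2 (fun h => hxy (Subtype.ext h))
      exact closedBall_disjoint_closedBall (by linarith)
    have hcount := Measure.countable_meas_pos_of_disjoint_iUnion (μ := μ)
      (fun x : N => measurableSet_closedBall) hdisj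
    have huniv : {x : N | 0 < μ (closedBall (x : X) (ε / 2))} = univ :=
      eq_univ_of_forall fun x => (hball x _ (by positivity)).1
    rw [huniv] at hcount
    exact countable_coe_iff.1 (countable_univ_iff.1 hcount)
  · intro x
    by_contra! hcon
    have hx : x ∉ N := fun h => by
      have := hcon x h
      rw [dist_self] at this
      linarith
    refine hx (hN.le_of_ge (y := insert x N) ?_ (subset_insert x N) (mem_insert x N))
    have : Std.Symm fun x y : X => ε < dist x y := ⟨fun a b hab => by rwa [dist_comm]⟩
    exact pairwise_insert_of_symm.2 ⟨hN.prop, fun y hy _ => hcon y hy⟩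

variable {D : ℝ≥0}

theorem measure_closedBall_two_pow_mul_le
    (hD : ∀ (x : X) (r : ℝ), 0 < r → μ (closedBall x (2 * r)) ≤ D * μ (closedBall x r))
    (n : ℕ) (x : X) {r : ℝ} (hr : 0 < r) :
    μ (closedBall x (2 ^ n * r)) ≤ (D ^ n : ℝ≥0) * μ (closedBall x r) := by
  induction n with
  | zero => simp
  | succ n ih =>
    calc μ (closedBall x (2 ^ (n + 1) * r)) = μ (closedBall x (2 * (2 ^ n * r))) := by
          rw [pow_succ']; ring_nf
      _ ≤ D * μ (closedBall x (2 ^ n * r)) := hD _ _ (by positivity)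
      _ ≤ D * ((D ^ n : ℝ≥0) * μ (closedBall x r)) := by gcongr
      _ = _ := by rw [← mul_assoc, pow_succ']; push_cast; rfl

/-- Balls of comparable radii and positions have comparable measures. -/
theorem exists_measure_closedBall_le
    (hD : ∀ (x : X) (r : ℝ), 0 < r → μ (closedBall x (2 * r)) ≤ D * μ (closedBall x r)) (c : ℝ) :
    ∃ K : ℝ≥0, ∀ (x y : X) (r : ℝ), 0 < r → dist x y ≤ c * r →
      μ (closedBall y (c * r)) ≤ K * μ (closedBall x r) := by
  obtain ⟨n, hn⟩ := pow_unbounded_of_one_lt (2 * c) one_lt_two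
  refine ⟨D ^ n, fun x y r hr hxy => ?_⟩
  refine le_trans (measure_mono (closedBall_subset_closedBall' ?_))
    (measure_closedBall_two_pow_mul_le hD n x hr)
  rw [dist_comm]
  nlinarith

/-- Every ball around `x` is disjoint from some ball of comparable measure, centred far away. Hence
`μ(B) * (1 + 1/K) ≤ μ X` for arbitrarily large `B`, which is impossible in the limit if `0 < μ X <
∞`. -/
theorem measure_univ_eq_top [BorelSpace X]
    (hball : ∀ (x : X) (r : ℝ), 0 < r → 0 < μ (closedBall x r) ∧ μ (closedBall x r) < ∞)
    (hD : ∀ (x : X) (r : ℝ), 0 < r → μ (closedBall x (2 * r)) ≤ D * μ (closedBall x r))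
    (hunbounded : ¬ Bornology.IsBounded (univ : Set X)) : μ univ = ∞ := by
  obtain ⟨K, hK⟩ := exists_measure_closedBall_le hD 4
  have hne : Nonempty X := by
    by_contra h
    rw [not_nonempty_iff] at h
    exact hunbounded (by rw [univ_eq_empty_iff.2 h]; exact Bornology.isBounded_empty)
  obtain ⟨x⟩ := hne
  have key : ∀ n : ℕ, μ (closedBall x (n + 1)) + μ (closedBall x (n + 1)) / K ≤ μ univ := by
    intro n
    obtain ⟨y, hy⟩ : ∃ y, 3 * ((n : ℝ) + 1) < dist y x := by
      by_contra! hcon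
      exact hunbounded ((isBounded_iff_subset_closedBall x).2 ⟨_, fun y _ => hcon y⟩)
    set r := dist y x / 3 with hr
    have hnr : (n : ℝ) + 1 ≤ r := by linarith
    have hr0 : 0 < r := lt_of_lt_of_le (by positivity) hnr
    have hdisj : Disjoint (closedBall x (n + 1)) (closedBall y r) := by
      refine closedBall_disjoint_closedBall ?_
      rw [dist_comm]
      linarith
    have h1 : μ (closedBall x (n + 1)) ≤ K * μ (closedBall y r) := by
      refine le_trans (measure_mono (closedBall_subset_closedBall ?_))
        (hK y x r hr0 (by linarith))
      linarith
    calc μ (closedBall x (n + 1)) + μ (closedBall x (n + 1)) / K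
        ≤ μ (closedBall x (n + 1)) + μ (closedBall y r) := by
          gcongr
          exact ENNReal.div_le_of_le_mul' h1
      _ = μ (closedBall x (n + 1) ∪ closedBall y r) :=
          (measure_union hdisj measurableSet_closedBall).symm
      _ ≤ μ univ := measure_mono (subset_univ _)
  have hlim : Tendsto (fun n : ℕ => μ (closedBall x (n + 1))) atTop (𝓝 (μ univ)) := by
    have hU : ⋃ n : ℕ, closedBall x ((n : ℝ) + 1) = univ := by
      rw [eq_univ_iff_forall]
      intro y
      obtain ⟨n, hn⟩ := exists_nat_ge (dist y x)
      exact mem_iUnion.2 ⟨n, by rw [mem_closedBall]; linarith⟩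
    rw [← hU]
    refine tendsto_measure_iUnion_atTop ?_
    intro m n hmn
    refine closedBall_subset_closedBall ?_
    have : (m : ℝ) ≤ n := by exact_mod_cast hmn
    linarith
  have hpos : μ univ ≠ 0 :=
    ((hball x 1 one_pos).1.trans_le (measure_mono (subset_univ _))).ne'
  by_contra htop
  have hle : μ univ + μ univ / K ≤ μ univ := by
    refine le_of_tendsto' (hlim.add (ENNReal.Tendsto.div_const hlim (Or.inl hpos))) key
  have h2 : μ univ / K ≠ 0 := by
    rw [Ne, ENNReal.div_eq_zero_iff, not_or]
    exact ⟨hpos, ENNReal.coe_ne_top⟩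
  exact absurd hle (not_le.2 (ENNReal.lt_add_right htop h2))

theorem tendsto_measure_closedBall_atTop
    (htop : μ univ = ∞) (x : X) {R : ℕ → ℝ} (hR : Monotone R) (hR' : Tendsto R atTop atTop) :
    Tendsto (fun n => μ (closedBall x (R n))) atTop (𝓝 ∞) := by
  have hU : ⋃ n : ℕ, closedBall x (R n) = univ := by
    rw [eq_univ_iff_forall]
    intro y
    obtain ⟨n, hn⟩ := (hR'.eventually_ge_atTop (dist y x)).exists
    exact mem_iUnion.2 ⟨n, hn⟩
  rw [← htop, ← hU]
  exact tendsto_measure_iUnion_atTop fun m n hmn => closedBall_subset_closedBall (hR hmn)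

theorem measurable_indicator_dist_le [BorelSpace X] [SecondCountableTopology X] (R : ℝ) :
    Measurable (Function.uncurry fun x y : X => (closedBall x R).indicator (1 : X → ℝ≥0∞) y) := by
  have hset : MeasurableSet {z : X × X | dist z.2 z.1 ≤ R} :=
    (isClosed_le (continuous_snd.dist continuous_fst) continuous_const).measurableSet
  exact (measurable_one (α := ℝ≥0∞)).indicator hset

theorem lintegral_closedBall_eq [BorelSpace X] (H : X → ℝ≥0∞) (x : X) (R : ℝ) :
    ∫⁻ y in closedBall x R, H y ∂μ = ∫⁻ y, (closedBall x R).indicator 1 y * H y ∂μ := by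
  rw [← lintegral_indicator measurableSet_closedBall]
  refine lintegral_congr fun y => ?_
  by_cases hy : y ∈ closedBall x R <;> simp [hy]

theorem measurable_laverage_closedBall [BorelSpace X] [SecondCountableTopology X] [SFinite μ]
    {H : X → ℝ≥0∞} (hH : Measurable H) (R : ℝ) :
    Measurable fun x => ⨍⁻ y in closedBall x R, H y ∂μ := by
  have key : ∀ F : X → ℝ≥0∞, Measurable F →
      Measurable fun x => ∫⁻ y in closedBall x R, F y ∂μ := by
    intro F hF
    simp_rw [lintegral_closedBall_eq]
    exact Measurable.lintegral_prod_right'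
      (f := fun z : X × X => (closedBall z.1 R).indicator 1 z.2 * F z.2)
      ((measurable_indicator_dist_le R).mul (hF.comp measurable_snd))
  simp_rw [setLAverage_eq]
  refine (key H hH).div ?_
  simpa using key 1 measurable_one

/-- Interchange of integration over balls with a doubling measure. -/
theorem lintegral_mul_laverage_le [BorelSpace X] [SecondCountableTopology X] [SFinite μ]
    (hball : ∀ (x : X) (r : ℝ), 0 < r → 0 < μ (closedBall x r) ∧ μ (closedBall x r) < ∞)
    (hD : ∀ (x : X) (r : ℝ), 0 < r → μ (closedBall x (2 * r)) ≤ D * μ (closedBall x r))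
    {w H : X → ℝ≥0∞} (hw : Measurable w) (hH : Measurable H) {R : ℝ} (hR : 0 < R) :
    ∫⁻ x, w x * ⨍⁻ y in closedBall x R, H y ∂μ ∂μ ≤
      D * ∫⁻ y, H y * ⨍⁻ x in closedBall y R, w x ∂μ ∂μ := by
  set I : X → X → ℝ≥0∞ := fun x y => (closedBall x R).indicator 1 y with hI
  have hIm : Measurable (Function.uncurry I) := measurable_indicator_dist_le R
  have hIs : ∀ x y, I x y = I y x := fun x y => by
    simp only [hI, indicator, mem_closedBall, dist_comm, Pi.one_apply]
  have hIx : ∀ x, Measurable (I x) := fun x => hIm.comp measurable_prodMk_left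
  have hmeas : Measurable fun y => μ (closedBall y R) := by
    have h : Measurable fun y => ∫⁻ x, I y x ∂μ :=
      Measurable.lintegral_prod_right' (f := Function.uncurry I) hIm
    have e : ∀ y, ∫⁻ x, I y x ∂μ = μ (closedBall y R) := fun y =>
      lintegral_indicator_one measurableSet_closedBall
    simpa only [e] using h
  -- For `y ∈ B(x,R)` one has `B(y,R) ⊆ B(x,2R)`, so normalizing by `μ(B(y,R))` instead of
  -- `μ(B(x,R))` costs the factor `D`. After that Tonelli's theorem applies.
  have hle : ∀ x, w x * ⨍⁻ y in closedBall x R, H y ∂μ ≤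
      ∫⁻ y, w x * (I x y * (D * (H y / μ (closedBall y R)))) ∂μ := by
    intro x
    have hm : Measurable fun y => I x y * (D * (H y / μ (closedBall y R))) :=
      (hIx x).mul ((hH.div hmeas).const_mul _)
    have hm' : Measurable fun y => (closedBall x R).indicator 1 y * H y := (hIx x).mul hH
    rw [lintegral_const_mul _ hm, setLAverage_eq, ENNReal.div_eq_inv_mul, lintegral_closedBall_eq,
      ← lintegral_const_mul _ hm']
    refine mul_le_mul_right (lintegral_mono fun y => ?_) _
    by_cases hy : y ∈ closedBall x R
    · have hI1 : I x y = 1 := indicator_of_mem hy _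
      change (μ (closedBall x R))⁻¹ * (I x y * H y) ≤ I x y * _
      rw [hI1, one_mul, one_mul, ENNReal.div_eq_inv_mul, ← mul_assoc]
      gcongr
      have h1 : μ (closedBall y R) ≤ D * μ (closedBall x R) := by
        refine le_trans (measure_mono (closedBall_subset_closedBall' ?_)) (hD x R hR)
        rw [mem_closedBall] at hy
        linarith
      have hx := hball x R hR
      have hy := hball y R hR
      calc (μ (closedBall x R))⁻¹
          = (μ (closedBall x R))⁻¹ * (μ (closedBall y R) * (μ (closedBall y R))⁻¹) := by
            rw [ENNReal.mul_inv_cancel hy.1.ne' hy.2.ne, mul_one]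
        _ ≤ (μ (closedBall x R))⁻¹ * (D * μ (closedBall x R) * (μ (closedBall y R))⁻¹) := by
            gcongr
        _ = (μ (closedBall x R))⁻¹ * μ (closedBall x R) * (D * (μ (closedBall y R))⁻¹) := by ring
        _ = _ := by rw [ENNReal.inv_mul_cancel hx.1.ne' hx.2.ne, one_mul]
    · have hI0 : I x y = 0 := indicator_of_notMem hy _
      change (μ (closedBall x R))⁻¹ * (I x y * H y) ≤ I x y * _
      simp [hI0]
  calc ∫⁻ x, w x * ⨍⁻ y in closedBall x R, H y ∂μ ∂μ
      ≤ ∫⁻ x, ∫⁻ y, w x * (I x y * (D * (H y / μ (closedBall y R)))) ∂μ ∂μ :=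
        lintegral_mono hle
    _ = ∫⁻ y, ∫⁻ x, w x * (I x y * (D * (H y / μ (closedBall y R)))) ∂μ ∂μ := by
        refine lintegral_lintegral_swap (Measurable.aemeasurable ?_)
        exact (hw.comp measurable_fst).mul (hIm.mul
          (((hH.div hmeas).const_mul _).comp measurable_snd))
    _ = ∫⁻ y, D * (H y * ⨍⁻ x in closedBall y R, w x ∂μ) ∂μ := by
        refine lintegral_congr fun y => ?_
        have e : ∀ x, w x * (I x y * (D * (H y / μ (closedBall y R)))) =
            (I y x * w x) * (D * (H y / μ (closedBall y R))) := fun x => by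
          rw [hIs x y]
          ring
        simp_rw [e]
        have hm : Measurable fun x => I y x * w x := (hIx y).mul hw
        rw [lintegral_mul_const _ hm, setLAverage_eq, lintegral_closedBall_eq,
          ENNReal.div_eq_inv_mul, ENNReal.div_eq_inv_mul]
        ring
    _ = _ := lintegral_const_mul' _ _ ENNReal.coe_ne_top

end Doubling

/-! ### Sums of powers over dyadic scales -/

section GeometricSums

/-- A geometric series starting at the first power of `2` that reaches `r`. The constant is kept
explicit because it is later used with `a = -β → 0`, where its rate of blow-up matters. -/
theorem tsum_zpow_rpow_neg_le {a r : ℝ} (ha : 0 < a) (hr : 0 < r) :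
    ∑' m : ℤ, (if r ≤ (2 : ℝ) ^ m then ENNReal.ofReal (((2 : ℝ) ^ m) ^ (-a)) else 0) ≤
      ENNReal.ofReal (r ^ (-a) * (1 - 2 ^ (-a))⁻¹) := by
  obtain ⟨n, hn⟩ := exists_mem_Ioc_zpow hr (one_lt_two (α := ℝ))
  set f : ℤ → ℝ≥0∞ :=
    fun m => if r ≤ (2 : ℝ) ^ m then ENNReal.ofReal (((2 : ℝ) ^ m) ^ (-a)) else 0 with hf
  have hinj : Function.Injective fun k : ℕ => n + 1 + (k : ℤ) := by
    intro i j hij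
    simpa using hij
  have hsupp : Function.support f ⊆ range fun k : ℕ => n + 1 + (k : ℤ) := by
    intro m hm
    have hrm : r ≤ (2 : ℝ) ^ m := by
      by_contra h
      exact hm (if_neg h)
    have hlt : n < m := (zpow_lt_zpow_iff_right₀ (one_lt_two (α := ℝ))).1 (hn.1.trans_le hrm)
    exact ⟨(m - (n + 1)).toNat, by simp only; omega⟩
  have h2 : (2 : ℝ) ^ (-a) < 1 := Real.rpow_lt_one_of_one_lt_of_neg one_lt_two (by linarith)
  rw [← hinj.tsum_eq hsupp]
  calc ∑' k : ℕ, f (n + 1 + (k : ℤ))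
      ≤ ∑' k : ℕ, ENNReal.ofReal (r ^ (-a)) * ENNReal.ofReal (2 ^ (-a)) ^ k := by
        refine ENNReal.tsum_le_tsum fun k => ?_
        simp only [hf]
        split_ifs
        · rw [← ENNReal.ofReal_pow (by positivity), ← ENNReal.ofReal_mul (by positivity)]
          refine ENNReal.ofReal_le_ofReal ?_
          rw [zpow_add₀ two_ne_zero, Real.mul_rpow (by positivity) (by positivity), zpow_natCast,
            ← Real.rpow_natCast, ← Real.rpow_natCast, ← Real.rpow_mul (by positivity),
            ← Real.rpow_mul (by positivity), mul_comm (k : ℝ)]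
          gcongr ?_ * _
          exact Real.rpow_le_rpow_of_nonpos hr hn.2 (by linarith)
        · exact zero_le
    _ = ENNReal.ofReal (r ^ (-a)) * (1 - ENNReal.ofReal (2 ^ (-a)))⁻¹ := by
        rw [ENNReal.tsum_mul_left, ENNReal.tsum_geometric]
    _ = _ := by
        rw [ENNReal.ofReal_mul (by positivity), ENNReal.ofReal_inv_of_pos (by linarith),
          ENNReal.ofReal_sub _ (by positivity), ENNReal.ofReal_one]

/-- The substitution `m ↦ -m`, `r ↦ r⁻¹` turns this into the preceding sum. -/
theorem tsum_zpow_rpow_le {a r : ℝ} (ha : 0 < a) (hr : 0 < r) :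
    ∑' m : ℤ, (if (2 : ℝ) ^ m < r then ENNReal.ofReal (((2 : ℝ) ^ m) ^ a) else 0) ≤
      ENNReal.ofReal (r ^ a * (1 - 2 ^ (-a))⁻¹) := by
  have h := tsum_zpow_rpow_neg_le ha (inv_pos.2 hr)
  rw [← (Equiv.neg ℤ).tsum_eq, Real.inv_rpow hr.le, Real.rpow_neg hr.le, inv_inv] at h
  refine le_trans (ENNReal.tsum_le_tsum fun m => ?_) h
  simp only [Equiv.neg_apply, zpow_neg]
  split_ifs with h1 h2
  · rw [Real.inv_rpow (by positivity), Real.rpow_neg (by positivity), inv_inv]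
  · exact absurd (inv_anti₀ (by positivity) h1.le) h2
  · exact zero_le
  · exact zero_le

/-- A weighted form of the power mean inequality for sums over dyadic scales. -/
theorem tsum_rpow_le_tsum_scale {q θ d : ℝ} (hq : 0 < q) (hθ : 0 < θ) (hd : 0 < d)
    (a : ℤ → ℝ≥0∞) :
    (∑' m, a m) ^ q ≤ ENNReal.ofReal (2 * (1 - 2 ^ (-θ))⁻¹) ^ q *
      ∑' m : ℤ, ENNReal.ofReal (((2 : ℝ) ^ m / d) ^ (θ * q) + ((2 : ℝ) ^ m / d) ^ (-(θ * q)))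
        * a m ^ q := by
  set S := ∑' m : ℤ, ENNReal.ofReal (((2 : ℝ) ^ m / d) ^ (θ * q) + ((2 : ℝ) ^ m / d) ^ (-(θ * q)))
        * a m ^ q with hS
  -- Summable weights that decay geometrically on both sides of the scale `2 ^ m ≈ d`; their sum is
  -- bounded independently of `d`.
  set c : ℤ → ℝ := fun m => if d ≤ (2 : ℝ) ^ m then ((2 : ℝ) ^ m / d) ^ (-θ) else
    ((2 : ℝ) ^ m / d) ^ θ with hc
  have h2 : (2 : ℝ) ^ (-θ) < 1 := Real.rpow_lt_one_of_one_lt_of_neg one_lt_two (by linarith)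
  have hcpos : ∀ m, 0 < c m := by
    intro m
    simp only [hc]
    split_ifs <;> positivity
  have hcle : ∀ m, ((c m)⁻¹) ^ q ≤
      ((2 : ℝ) ^ m / d) ^ (θ * q) + ((2 : ℝ) ^ m / d) ^ (-(θ * q)) := by
    intro m
    have hb : (0 : ℝ) < (2 : ℝ) ^ m / d := by positivity
    simp only [hc]
    split_ifs
    · rw [← Real.rpow_neg hb.le, neg_neg, ← Real.rpow_mul hb.le]
      exact le_add_of_nonneg_right (by positivity)
    · rw [← Real.rpow_neg hb.le, ← Real.rpow_mul hb.le, neg_mul]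
      exact le_add_of_nonneg_left (by positivity)
  -- Each single term is dominated by `S`. This replaces Hölder's inequality and works for every `q
  -- > 0`.
  have hterm : ∀ m, a m ≤ ENNReal.ofReal (c m) * S ^ (1 / q) := by
    intro m
    have h1 : (ENNReal.ofReal (c m)⁻¹ * a m) ^ q ≤ S := by
      rw [ENNReal.mul_rpow_of_nonneg _ _ hq.le,
        ENNReal.ofReal_rpow_of_nonneg (inv_nonneg.2 (hcpos m).le) hq.le]
      refine le_trans ?_ (ENNReal.le_tsum m)
      gcongr
      exact hcle m
    have h3 : ENNReal.ofReal (c m)⁻¹ * a m ≤ S ^ (1 / q) := by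
      rw [one_div]
      exact (ENNReal.le_rpow_inv_iff hq).2 h1
    calc a m = ENNReal.ofReal (c m) * (ENNReal.ofReal (c m)⁻¹ * a m) := by
          rw [← mul_assoc, ← ENNReal.ofReal_mul (hcpos m).le, mul_inv_cancel₀ (hcpos m).ne',
            ENNReal.ofReal_one, one_mul]
      _ ≤ _ := by gcongr
  have hsum : ∑' m, ENNReal.ofReal (c m) ≤ ENNReal.ofReal (2 * (1 - 2 ^ (-θ))⁻¹) := by
    have e : ∀ m, ENNReal.ofReal (c m) =
        ENNReal.ofReal (d ^ θ) *
          (if d ≤ (2 : ℝ) ^ m then ENNReal.ofReal (((2 : ℝ) ^ m) ^ (-θ)) else 0)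
        + ENNReal.ofReal (d ^ (-θ)) *
          (if (2 : ℝ) ^ m < d then ENNReal.ofReal (((2 : ℝ) ^ m) ^ θ) else 0) := by
      intro m
      have hb : (0 : ℝ) < (2 : ℝ) ^ m := by positivity
      simp only [hc]
      split_ifs with h1 h2
      · exact absurd h1 (not_le.2 h2)
      · rw [mul_zero, add_zero, ← ENNReal.ofReal_mul (by positivity),
          Real.div_rpow hb.le hd.le, Real.rpow_neg hd.le, div_inv_eq_mul, mul_comm]
      · rw [mul_zero, zero_add, ← ENNReal.ofReal_mul (by positivity),
          Real.div_rpow hb.le hd.le, Real.rpow_neg hd.le, div_eq_inv_mul]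
      · exact absurd (not_le.1 h1) ‹_›
    simp_rw [e]
    rw [ENNReal.tsum_add, ENNReal.tsum_mul_left, ENNReal.tsum_mul_left]
    refine (add_le_add (mul_le_mul_right (tsum_zpow_rpow_neg_le hθ hd) _)
      (mul_le_mul_right (tsum_zpow_rpow_le hθ hd) _)).trans ?_
    have h3 : 0 < (1 - (2 : ℝ) ^ (-θ))⁻¹ := inv_pos.2 (by linarith)
    rw [← ENNReal.ofReal_mul (by positivity), ← ENNReal.ofReal_mul (by positivity),
      ← ENNReal.ofReal_add (by positivity) (by positivity)]
    refine ENNReal.ofReal_le_ofReal (le_of_eq ?_)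
    rw [← mul_assoc, ← mul_assoc, ← Real.rpow_add hd, ← Real.rpow_add hd]
    simp
    ring
  calc (∑' m, a m) ^ q ≤ (∑' m, ENNReal.ofReal (c m) * S ^ (1 / q)) ^ q := by
        gcongr with m
        exact hterm m
    _ = (∑' m, ENNReal.ofReal (c m)) ^ q * S := by
        rw [ENNReal.tsum_mul_right, ENNReal.mul_rpow_of_nonneg _ _ hq.le, ← ENNReal.rpow_mul,
          one_div, inv_mul_cancel₀ hq.ne', ENNReal.rpow_one]
    _ ≤ _ := by gcongr

end GeometricSums

/-! ### Integrability of negative powers of the distance -/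

section Codimension

variable {X : Type*} [MetricSpace X] [MeasurableSpace X] {μ : Measure X} {D : ℝ≥0}

/-- Small codimension of a closed set gives integrability of negative powers of the distance to
the set, with a constant that is uniform in the exponent. -/
theorem exists_lintegral_infDist_rpow_le [BorelSpace X]
    (hball : ∀ (x : X) (r : ℝ), 0 < r → 0 < μ (closedBall x r) ∧ μ (closedBall x r) < ∞)
    (hD : ∀ (x : X) (r : ℝ), 0 < r → μ (closedBall x (2 * r)) ≤ D * μ (closedBall x r))
    {E : Set X} (hE : E.Nonempty) (hEc : IsClosed E) {t : ℝ} {C : ℝ≥0}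
    (hcodim : ∀ z ∈ E, ∀ r R : ℝ, 0 < r → r < R →
      μ (thickening r E ∩ closedBall z R) / μ (closedBall z R) ≤
        (C : ℝ≥0∞) * ENNReal.ofReal ((r / R) ^ t))
    {s₁ : ℝ} (hs₁ : 0 ≤ s₁) (hst : s₁ < t) :
    ∃ K : ℝ≥0, ∀ s, 0 ≤ s → s ≤ s₁ → ∀ (y : X) (R : ℝ), 0 < R → infDist y E ≤ 2 * R →
      ∫⁻ x in closedBall y R ∩ Eᶜ, ENNReal.ofReal (infDist x E ^ (-s)) ∂μ ≤
        K * ENNReal.ofReal (R ^ (-s)) * μ (closedBall y R) := by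
  obtain ⟨K₁, hK₁⟩ := exists_measure_closedBall_le hD 16
  have hρ : (1 / 2 : ℝ) ^ (t - s₁) < 1 :=
    Real.rpow_lt_one (by norm_num) (by norm_num) (by linarith)
  set Γ : ℝ≥0∞ := (1 - ENNReal.ofReal ((1 / 2 : ℝ) ^ (t - s₁)))⁻¹ with hΓ
  have hΓfin : Γ ≠ ∞ := by
    rw [hΓ, Ne, ENNReal.inv_eq_top, tsub_eq_zero_iff_le, not_le]
    simpa using hρ
  have hB : ∀ y (R : ℝ), 0 < R → ∀ x ∈ closedBall y R, infDist y E ≤ 2 * R →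
      infDist x E ≤ 3 * R := by
    intro y R hR x hx hy
    have := infDist_le_infDist_add_dist (s := E) (x := x) (y := y)
    rw [mem_closedBall] at hx
    linarith
  have hdpos : ∀ x ∈ Eᶜ, 0 < infDist x E := fun x hx =>
    (hEc.notMem_iff_infDist_pos hE).1 hx
  -- Only the largest exponent `s₁` needs the dyadic decomposition, whose ratio is `2^(-(t - s₁))`.
  -- For smaller `s` one uses `d^(-s) ≤ (3R)^(s₁-s) * d^(-s₁)` on the ball, which makes the constant
  -- uniform in `s`.
  have main : ∀ (y : X) (R : ℝ), 0 < R → infDist y E ≤ 2 * R →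
      ∫⁻ x in closedBall y R ∩ Eᶜ, ENNReal.ofReal (infDist x E ^ (-s₁)) ∂μ ≤
        C * K₁ * Γ * ENNReal.ofReal (R ^ (-s₁)) * μ (closedBall y R) := by
    intro y R hR hy
    -- A point with `2^(-k-1) * 4R < d ≤ 2^(-k) * 4R` lies in the thickening of radius `r k`, the
    -- doubled radius giving the strict inequality, and there `d^(-s₁) ≤ c k`. Every point of the
    -- ball is covered since `d ≤ 3R`.
    set r : ℕ → ℝ := fun k => (1 / 2) ^ k * (8 * R) with hr
    set c : ℕ → ℝ := fun k => ((1 / 2) ^ k * (2 * R)) ^ (-s₁) with hc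
    have hthick : ∀ k, MeasurableSet (thickening (r k) E) := fun k =>
      isOpen_thickening.measurableSet
    have hpoint : ∀ x ∈ closedBall y R ∩ Eᶜ, ENNReal.ofReal (infDist x E ^ (-s₁)) ≤
        ∑' k, ENNReal.ofReal (c k) * (thickening (r k) E).indicator 1 x := by
      rintro x ⟨hx, hxE⟩
      have hd := hdpos x hxE
      have hd3 := hB y R hR x hx hy
      obtain ⟨k, hk1, hk2⟩ := exists_nat_pow_near_of_lt_one (x := infDist x E / (4 * R))
        (y := (1 / 2 : ℝ)) (by positivity) ((div_le_one (by positivity)).2 (by linarith))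
        (by norm_num) (by norm_num)
      rw [lt_div_iff₀ (by positivity)] at hk1
      rw [div_le_iff₀ (by positivity)] at hk2
      refine le_trans ?_ (ENNReal.le_tsum k)
      have hmem : x ∈ thickening (r k) E := by
        rw [mem_thickening_iff_infDist_lt hE]
        refine hk2.trans_lt ?_
        simp only [hr]
        gcongr
        norm_num
      rw [indicator_of_mem hmem, Pi.one_apply, mul_one]
      refine ENNReal.ofReal_le_ofReal (Real.rpow_le_rpow_of_nonpos (by positivity) ?_
        (by linarith))
      refine le_trans (le_of_eq ?_) hk1.le
      rw [pow_succ]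
      ring
    -- The codimension condition is centred on `E`, so the ball is moved to `z`. The radius `16 * R`
    -- contains `B(y,R)` and exceeds every `r k ≤ 8 * R`.
    obtain ⟨z, hz, hyz⟩ := (infDist_lt_iff hE).1 (show infDist y E < 3 * R by linarith)
    have hzball := hball z (16 * R) (by positivity)
    have hmeas : ∀ k, μ (thickening (r k) E ∩ closedBall y R) ≤
        C * ENNReal.ofReal ((r k / (16 * R)) ^ t) * (K₁ * μ (closedBall y R)) := by
      intro k
      have hrk : r k ≤ 8 * R := by
        simp only [hr]
        have : (1 / 2 : ℝ) ^ k ≤ 1 := pow_le_one₀ (by norm_num) (by norm_num)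
        nlinarith
      have h1 := hcodim z hz (r k) (16 * R) (by simp only [hr]; positivity) (by linarith)
      rw [ENNReal.div_le_iff hzball.1.ne' hzball.2.ne] at h1
      calc μ (thickening (r k) E ∩ closedBall y R)
          ≤ μ (thickening (r k) E ∩ closedBall z (16 * R)) := by
            refine measure_mono (inter_subset_inter_right _ (closedBall_subset_closedBall' ?_))
            linarith
        _ ≤ C * ENNReal.ofReal ((r k / (16 * R)) ^ t) * μ (closedBall z (16 * R)) := h1
        _ ≤ _ := by
            gcongr
            exact hK₁ y z R hR (by linarith)
    calc ∫⁻ x in closedBall y R ∩ Eᶜ, ENNReal.ofReal (infDist x E ^ (-s₁)) ∂μ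
        ≤ ∫⁻ x in closedBall y R ∩ Eᶜ,
            ∑' k, ENNReal.ofReal (c k) * (thickening (r k) E).indicator 1 x ∂μ :=
          setLIntegral_mono' (measurableSet_closedBall.inter hEc.measurableSet.compl) hpoint
      _ ≤ ∫⁻ x in closedBall y R,
            ∑' k, ENNReal.ofReal (c k) * (thickening (r k) E).indicator 1 x ∂μ :=
          lintegral_mono_set inter_subset_left
      _ = ∑' k, ENNReal.ofReal (c k) * μ (thickening (r k) E ∩ closedBall y R) := by
          rw [lintegral_tsum fun k => ((measurable_one.indicator (hthick k)).const_mul _).aemeasurable]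
          refine tsum_congr fun k => ?_
          rw [lintegral_const_mul _ (measurable_one.indicator (hthick k)),
            lintegral_indicator_one (hthick k), Measure.restrict_apply (hthick k)]
      _ ≤ ∑' k, C * K₁ * ENNReal.ofReal (R ^ (-s₁)) * μ (closedBall y R) *
            ENNReal.ofReal ((1 / 2 : ℝ) ^ (t - s₁)) ^ k := by
          refine ENNReal.tsum_le_tsum fun k => ?_
          refine (mul_le_mul_right (hmeas k) _).trans ?_
          have hreal : c k * (r k / (16 * R)) ^ t ≤
              R ^ (-s₁) * ((1 / 2 : ℝ) ^ (t - s₁)) ^ k := by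
            have hp : (0 : ℝ) < (1 / 2) ^ k := by positivity
            have h1 : c k ≤ ((1 / 2 : ℝ) ^ k) ^ (-s₁) * R ^ (-s₁) := by
              rw [← Real.mul_rpow hp.le hR.le]
              refine Real.rpow_le_rpow_of_nonpos (by positivity) ?_ (by linarith)
              gcongr
              linarith
            have h2 : (r k / (16 * R)) ^ t ≤ ((1 / 2 : ℝ) ^ k) ^ t := by
              refine Real.rpow_le_rpow (by simp only [hr]; positivity) ?_ (by linarith)
              simp only [hr]
              rw [div_le_iff₀ (by positivity)]
              nlinarith [mul_pos hp hR]
            have h3 : ((1 / 2 : ℝ) ^ (t - s₁)) ^ k = ((1 / 2 : ℝ) ^ k) ^ (-s₁)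
                * ((1 / 2 : ℝ) ^ k) ^ t := by
              rw [← Real.rpow_add hp, ← Real.rpow_natCast, ← Real.rpow_natCast,
                ← Real.rpow_mul (by norm_num), ← Real.rpow_mul (by norm_num)]
              congr 1
              ring
            rw [h3]
            calc c k * (r k / (16 * R)) ^ t
                ≤ (((1 / 2 : ℝ) ^ k) ^ (-s₁) * R ^ (-s₁)) * ((1 / 2 : ℝ) ^ k) ^ t := by
                  gcongr
              _ = _ := by ring
          have hE' : ENNReal.ofReal (c k) * ENNReal.ofReal ((r k / (16 * R)) ^ t) ≤
              ENNReal.ofReal (R ^ (-s₁)) * ENNReal.ofReal ((1 / 2 : ℝ) ^ (t - s₁)) ^ k := by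
            rw [← ENNReal.ofReal_pow (by positivity), ← ENNReal.ofReal_mul (by positivity),
              ← ENNReal.ofReal_mul (by positivity)]
            exact ENNReal.ofReal_le_ofReal hreal
          calc ENNReal.ofReal (c k) *
                (C * ENNReal.ofReal ((r k / (16 * R)) ^ t) * (K₁ * μ (closedBall y R)))
              = (ENNReal.ofReal (c k) * ENNReal.ofReal ((r k / (16 * R)) ^ t)) *
                (C * K₁ * μ (closedBall y R)) := by ring
            _ ≤ (ENNReal.ofReal (R ^ (-s₁)) * ENNReal.ofReal ((1 / 2 : ℝ) ^ (t - s₁)) ^ k) *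
                (C * K₁ * μ (closedBall y R)) := by gcongr
            _ = _ := by ring
      _ = _ := by
          rw [ENNReal.tsum_mul_left, ENNReal.tsum_geometric, ← hΓ]
          ring
  refine ⟨C * K₁ * Γ.toNNReal * (3 ^ s₁ : ℝ).toNNReal, fun s hs hss y R hR hy => ?_⟩
  calc ∫⁻ x in closedBall y R ∩ Eᶜ, ENNReal.ofReal (infDist x E ^ (-s)) ∂μ
      ≤ ∫⁻ x in closedBall y R ∩ Eᶜ, ENNReal.ofReal ((3 * R) ^ (s₁ - s)) *
          ENNReal.ofReal (infDist x E ^ (-s₁)) ∂μ := by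
        refine setLIntegral_mono' (measurableSet_closedBall.inter hEc.measurableSet.compl) ?_
        rintro x ⟨hx, hxE⟩
        have hd := hdpos x hxE
        rw [← ENNReal.ofReal_mul (by positivity)]
        refine ENNReal.ofReal_le_ofReal ?_
        rw [show -s = (s₁ - s) + (-s₁) by ring, Real.rpow_add hd]
        gcongr
        exact hB y R hR x hx hy
    _ = ENNReal.ofReal ((3 * R) ^ (s₁ - s)) *
          ∫⁻ x in closedBall y R ∩ Eᶜ, ENNReal.ofReal (infDist x E ^ (-s₁)) ∂μ :=
        lintegral_const_mul' _ _ ENNReal.ofReal_ne_top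
    _ ≤ ENNReal.ofReal ((3 * R) ^ (s₁ - s)) *
          (C * K₁ * Γ * ENNReal.ofReal (R ^ (-s₁)) * μ (closedBall y R)) := by
        gcongr
        exact main y R hR hy
    _ = C * K₁ * Γ * (ENNReal.ofReal ((3 * R) ^ (s₁ - s)) * ENNReal.ofReal (R ^ (-s₁))) *
          μ (closedBall y R) := by ring
    _ ≤ C * K₁ * Γ * (ENNReal.ofReal (3 ^ s₁) * ENNReal.ofReal (R ^ (-s))) *
          μ (closedBall y R) := by
        refine mul_le_mul_left (mul_le_mul_right ?_ _) _
        rw [← ENNReal.ofReal_mul (by positivity), ← ENNReal.ofReal_mul (by positivity)]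
        refine ENNReal.ofReal_le_ofReal ?_
        rw [Real.mul_rpow (by norm_num) hR.le, mul_assoc, ← Real.rpow_add hR]
        have : s₁ - s + -s₁ = -s := by ring
        rw [this]
        gcongr
        · norm_num
        · linarith
    _ = _ := by
        push_cast
        rw [ENNReal.coe_toNNReal hΓfin]
        simp only [ENNReal.ofReal]
        ring

end Codimension

/-! ### Telescoping of ball averages -/

section Telescoping

open Filter Topology

variable {X : Type*} [MetricSpace X] [MeasurableSpace X] {μ : Measure X} {D : ℝ≥0}

theorem enorm_setAverage_sub_le {X : Type*} [MeasurableSpace X] {μ : Measure X}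
    {B : Set X} {f : X → ℝ} (h0 : μ B ≠ 0) (htop : μ B ≠ ∞)
    (hf : IntegrableOn f B μ) (c : ℝ) :
    ‖(⨍ z in B, f z ∂μ) - c‖ₑ ≤ ⨍⁻ z in B, ‖f z - c‖ₑ ∂μ := by
  have hfin : IsFiniteMeasure (μ.restrict B) := ⟨by simpa using htop.lt_top⟩
  have hne : NeZero (μ.restrict B) := ⟨by simpa [Measure.restrict_eq_zero] using h0⟩
  have h1 : (⨍ z in B, f z ∂μ) - c = ⨍ z in B, (f z - c) ∂μ := by
    have hc : ⨍ _ in B, c ∂μ = c := average_const (μ.restrict B) c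
    rw [setAverage_eq, setAverage_eq, integral_sub hf (integrable_const c), smul_sub,
      ← setAverage_eq μ (fun _ : X => c) B, hc]
  rw [h1]
  exact enorm_integral_le_lintegral_enorm _

/-- Pointwise estimate of a function by the averages of an upper gradient over all dyadic
scales. -/
theorem SupportsPoincare.exists_enorm_le_tsum [BorelSpace X]
    (hball : ∀ (x : X) (r : ℝ), 0 < r → 0 < μ (closedBall x r) ∧ μ (closedBall x r) < ∞)
    (hD : ∀ (x : X) (r : ℝ), 0 < r → μ (closedBall x (2 * r)) ≤ D * μ (closedBall x r))
    (hunbounded : ¬ Bornology.IsBounded (univ : Set X)) {q : ℝ} (hP : SupportsPoincare μ q) :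
    ∃ (K : ℝ≥0) (lam : ℝ), 1 ≤ lam ∧ ∀ (v : X → ℝ) (h : X → ℝ≥0∞), Continuous v →
      (∃ M, ∀ x, |v x| ≤ M) → Bornology.IsBounded {x | v x ≠ 0} → IsUpperGradientOn h v univ →
      ∀ x, ‖v x‖ₑ ≤ K * ∑' m : ℤ, ENNReal.ofReal ((2 : ℝ) ^ m) *
        (⨍⁻ y in closedBall x (lam * 2 ^ m), h y ^ q ∂μ) ^ (1 / q) := by
  obtain ⟨C, lam, hlam, hP⟩ := hP
  refine ⟨D * C, lam, hlam, fun v h hv ⟨M, hM⟩ hbdd hh x => ?_⟩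
  have hfin : ∀ y r, μ (closedBall y r) < ∞ := fun y r =>
    (measure_mono (closedBall_subset_closedBall (le_max_left r 1))).trans_lt
      (hball y (max r 1) (by positivity)).2
  have hint : ∀ y r, IntegrableOn v (closedBall y r) μ := fun y r =>
    Measure.integrableOn_of_bounded (M := M) (hfin y r).ne hv.aestronglyMeasurable
      (ae_of_all _ fun z => hM z)
  have hpow : ∀ m : ℤ, (0 : ℝ) < 2 ^ m := fun m => by positivity
  set a : ℤ → ℝ := fun m => ⨍ z in closedBall x (2 ^ m), v z ∂μ with ha
  set T : ℤ → ℝ≥0∞ := fun m => ENNReal.ofReal ((2 : ℝ) ^ m) *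
        (⨍⁻ y in closedBall x (lam * 2 ^ m), h y ^ q ∂μ) ^ (1 / q) with hT
  have hdist : ∀ m (c : ℝ), ‖a m - c‖ₑ ≤ ⨍⁻ z in closedBall x (2 ^ m), ‖v z - c‖ₑ ∂μ := fun m c =>
    enorm_setAverage_sub_le (hball x _ (hpow m)).1.ne' (hball x _ (hpow m)).2.ne (hint _ _) c
  -- Poincaré is applied on the larger of the two balls; enlarging the ball of integration costs the
  -- doubling constant.
  have hstep : ∀ m, edist (a m) (a (m + 1)) ≤ D * C * T (m + 1) := by
    intro m
    have hb := hball x _ (hpow m)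
    have hb' := hball x _ (hpow (m + 1))
    have h2 : (2 : ℝ) ^ (m + 1) = 2 * 2 ^ m := by rw [zpow_add_one₀ two_ne_zero]; ring
    have hdoub : μ (closedBall x (2 ^ (m + 1))) ≤ D * μ (closedBall x (2 ^ m)) := by
      rw [h2]
      exact hD x _ (hpow m)
    calc edist (a m) (a (m + 1)) = ‖a m - a (m + 1)‖ₑ := edist_eq_enorm_sub _ _
      _ ≤ ⨍⁻ z in closedBall x (2 ^ m), ‖v z - a (m + 1)‖ₑ ∂μ := hdist m _
      _ = (∫⁻ z in closedBall x (2 ^ m), ‖v z - a (m + 1)‖ₑ ∂μ) / μ (closedBall x (2 ^ m)) :=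
          setLAverage_eq _ _ _
      _ ≤ (∫⁻ z in closedBall x (2 ^ (m + 1)), ‖v z - a (m + 1)‖ₑ ∂μ) /
            μ (closedBall x (2 ^ m)) := by
          gcongr ?_ / _
          refine lintegral_mono_set (closedBall_subset_closedBall ?_)
          linarith [hpow m]
      _ ≤ D * ((∫⁻ z in closedBall x (2 ^ (m + 1)), ‖v z - a (m + 1)‖ₑ ∂μ) /
            μ (closedBall x (2 ^ (m + 1)))) := by
          refine ENNReal.div_le_of_le_mul ?_
          set I := ∫⁻ z in closedBall x (2 ^ (m + 1)), ‖v z - a (m + 1)‖ₑ ∂μ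
          calc I = I / μ (closedBall x (2 ^ (m + 1))) * μ (closedBall x (2 ^ (m + 1))) :=
                (ENNReal.div_mul_cancel hb'.1.ne' hb'.2.ne).symm
            _ ≤ I / μ (closedBall x (2 ^ (m + 1))) * (D * μ (closedBall x (2 ^ m))) := by gcongr
            _ = _ := by ring
      _ = D * ⨍⁻ z in closedBall x (2 ^ (m + 1)), ‖v z - a (m + 1)‖ₑ ∂μ := by
          rw [setLAverage_eq]
      _ ≤ D * (C * T (m + 1)) := by
          gcongr
          refine (hP v h hv.measurable hint hh x _ (hpow (m + 1))).trans (le_of_eq ?_)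
          rw [mul_assoc]
      _ = _ := by ring
  have hsum : ∀ N : ℕ, edist (a (-N)) (a N) ≤ D * C * ∑' m, T m := by
    intro N
    have h1 := edist_le_range_sum_edist (fun i : ℕ => a (-N + i)) (2 * N)
    have e1 : (-(N : ℤ) + ((0 : ℕ) : ℤ)) = -N := by simp
    have e2 : (-(N : ℤ) + ((2 * N : ℕ) : ℤ)) = N := by push_cast; ring
    simp only [e1, e2] at h1
    refine h1.trans ?_
    have hinj : Function.Injective fun i : ℕ => -(N : ℤ) + i + 1 := by
      intro i j hij
      simpa using hij
    calc ∑ i ∈ Finset.range (2 * N), edist (a (-N + i)) (a (-N + (i + 1 : ℕ)))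
        ≤ ∑ i ∈ Finset.range (2 * N), D * C * T (-(N : ℤ) + i + 1) := by
          refine Finset.sum_le_sum fun i _ => ?_
          have := hstep (-(N : ℤ) + i)
          push_cast
          rwa [← add_assoc]
      _ = D * C * ∑ i ∈ Finset.range (2 * N), T (-(N : ℤ) + i + 1) := by
          rw [Finset.mul_sum]
      _ ≤ D * C * ∑' i : ℕ, T (-(N : ℤ) + i + 1) := by
          gcongr
          exact ENNReal.sum_le_tsum _
      _ ≤ _ := by
          gcongr
          exact ENNReal.tsum_comp_le_tsum_of_injective hinj T
  have hzpow : ∀ n : ℕ, (2 : ℝ) ^ (-(n : ℤ)) = (1 / 2) ^ n := fun n => by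
    rw [zpow_neg, zpow_natCast, one_div, inv_pow]
  have hsmall : ∀ ε : ℝ≥0, 0 < ε → ∀ᶠ n : ℕ in atTop, edist (v x) (a (-n)) ≤ ε := by
    intro ε hε
    obtain ⟨δ, hδ, hδ'⟩ := Metric.continuous_iff.1 hv x ε (by exact_mod_cast hε)
    have hlim : Tendsto (fun n : ℕ => (1 / 2 : ℝ) ^ n) atTop (𝓝 0) :=
      tendsto_pow_atTop_nhds_zero_of_lt_one (by norm_num) (by norm_num)
    filter_upwards [hlim.eventually_lt_const hδ] with n hn
    rw [edist_comm, edist_eq_enorm_sub]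
    refine (hdist _ _).trans ?_
    have hb := hball x _ (hpow (-n))
    rw [setLAverage_eq]
    refine ENNReal.div_le_of_le_mul ?_
    calc ∫⁻ z in closedBall x (2 ^ (-(n : ℤ))), ‖v z - v x‖ₑ ∂μ
        ≤ ∫⁻ _ in closedBall x (2 ^ (-(n : ℤ))), (ε : ℝ≥0∞) ∂μ := by
          refine setLIntegral_mono' measurableSet_closedBall fun z hz => ?_
          rw [← edist_eq_enorm_sub, edist_dist]
          refine ENNReal.ofReal_le_of_le_toReal ?_
          rw [ENNReal.coe_toReal]
          refine (hδ' z (lt_of_le_of_lt hz ?_)).le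
          rwa [hzpow]
      _ = _ := setLIntegral_const _ _
  -- The integral of `|v|` is finite while the measure of the balls tends to infinity, so the
  -- telescoping sum has no remainder at large scales.
  have hlarge : ∀ ε : ℝ≥0, 0 < ε → ∀ᶠ n : ℕ in atTop, edist (a n) 0 ≤ ε := by
    intro ε hε
    obtain ⟨R, hR⟩ := (isBounded_iff_subset_closedBall x).1 hbdd
    set I := ∫⁻ z, ‖v z‖ₑ ∂μ with hI
    have hIfin : I < ∞ := by
      have hIle : I ≤ ∫⁻ z in closedBall x R, ‖v z‖ₑ ∂μ := by
        rw [← lintegral_indicator measurableSet_closedBall]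
        refine lintegral_mono fun z => ?_
        by_cases hz : z ∈ closedBall x R
        · rw [indicator_of_mem hz]
        · have : v z = 0 := by
            by_contra h0
            exact hz (hR h0)
          simp [this]
      exact hIle.trans_lt (hint x R).2
    have hlim : Tendsto (fun n : ℕ => I / μ (closedBall x (2 ^ n))) atTop (𝓝 0) := by
      have h1 := tendsto_measure_closedBall_atTop (measure_univ_eq_top hball hD hunbounded) x
        (R := fun n => 2 ^ n) (pow_right_mono₀ one_le_two)
        (tendsto_pow_atTop_atTop_of_one_lt one_lt_two)
      have h2 := ENNReal.Tendsto.const_div h1 (Or.inr hIfin.ne)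
      rwa [ENNReal.div_top] at h2
    filter_upwards [hlim.eventually_lt_const (show (0 : ℝ≥0∞) < ε by exact_mod_cast hε)] with n hn
    rw [edist_eq_enorm_sub]
    refine (hdist _ _).trans (le_trans ?_ hn.le)
    rw [setLAverage_eq, zpow_natCast]
    gcongr
    simp only [sub_zero]
    exact setLIntegral_le_lintegral _ _
  refine ENNReal.le_of_forall_pos_le_add fun ε hε _ => ?_
  obtain ⟨n, hn1, hn2⟩ := ((hsmall (ε / 2) (by positivity)).and
    (hlarge (ε / 2) (by positivity))).exists
  calc ‖v x‖ₑ = edist (v x) 0 := by rw [edist_eq_enorm_sub, sub_zero]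
    _ ≤ edist (v x) (a (-n)) + edist (a (-n)) (a n) + edist (a n) 0 := edist_triangle4 _ _ _ _
    _ ≤ (ε / 2 : ℝ≥0) + D * C * (∑' m, T m) + (ε / 2 : ℝ≥0) := by
        gcongr
        exact hsum n
    _ = D * C * (∑' m, T m) + ((ε / 2 + ε / 2 : ℝ≥0) : ℝ≥0∞) := by push_cast; ring
    _ = _ := by rw [add_halves]; push_cast; rfl

end Telescoping

/-! ### Averages of the Hardy weight over dyadic balls -/

section Kernel

variable {X : Type*} [MetricSpace X] [MeasurableSpace X] {μ : Measure X} {D : ℝ≥0}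

/-- The weight of scale `r` in the estimates of Hardy type. -/
noncomputable def hardyKernel (E : Set X) (δ s r : ℝ) : X → ℝ≥0∞ :=
  Eᶜ.indicator fun x => ENNReal.ofReal
    (((r / infDist x E) ^ δ + (r / infDist x E) ^ (-δ)) * infDist x E ^ (-s))

theorem measurable_hardyKernel [BorelSpace X] {E : Set X} (hE : IsClosed E) (δ s r : ℝ) :
    Measurable (hardyKernel E δ s r) := by
  have hd : Measurable fun x => infDist x E := (continuous_infDist_pt E).measurable
  refine Measurable.indicator (ENNReal.measurable_ofReal.comp ?_) hE.measurableSet.compl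
  exact (((hd.const_div r).pow_const δ).add ((hd.const_div r).pow_const (-δ))).mul
    (hd.pow_const (-s))

theorem add_rpow_neg_mul_rpow_eq {r d : ℝ} (hr : 0 < r) (hd : 0 < d) (δ s : ℝ) :
    ((r / d) ^ δ + (r / d) ^ (-δ)) * d ^ (-s) =
      r ^ δ * d ^ (-(s + δ)) + r ^ (-δ) * d ^ (-(s - δ)) := by
  rw [Real.div_rpow hr.le hd.le, Real.div_rpow hr.le hd.le, add_mul, div_mul_eq_mul_div,
    div_mul_eq_mul_div, mul_div_assoc, mul_div_assoc, ← Real.rpow_sub hd, ← Real.rpow_sub hd]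
  congr 3 <;> ring

/-- The kernel splits into powers `d^(-(s ± δ))` with exponents in `[0, s₁]`, each controlled by
`hK`. After `R` is replaced by the smaller `r`, the factors `r^(±δ)` cancel. -/
theorem setLAverage_hardyKernel_le_near [BorelSpace X]
    {E : Set X} (hE : E.Nonempty) (hEc : IsClosed E) {s₁ : ℝ} {K : ℝ≥0}
    (hK : ∀ s, 0 ≤ s → s ≤ s₁ → ∀ (y : X) (R : ℝ), 0 < R → infDist y E ≤ 2 * R →
      ∫⁻ x in closedBall y R ∩ Eᶜ, ENNReal.ofReal (infDist x E ^ (-s)) ∂μ ≤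
        K * ENNReal.ofReal (R ^ (-s)) * μ (closedBall y R))
    {δ s r R : ℝ} (hδ : 0 ≤ δ) (hδs : δ ≤ s) (hs : s + δ ≤ s₁) (hr : 0 < r) (hrR : r ≤ R) {y : X}
    (hy : infDist y E ≤ 2 * R) :
    ⨍⁻ x in closedBall y R, hardyKernel E δ s r x ∂μ ≤ 2 * K * ENNReal.ofReal (r ^ (-s)) := by
  have hR : 0 < R := hr.trans_le hrR
  have hd : Measurable fun x => infDist x E := (continuous_infDist_pt E).measurable
  have hpart : ∀ e : ℝ, 0 ≤ s + e → s + e ≤ s₁ →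
      ∫⁻ x in closedBall y R ∩ Eᶜ, ENNReal.ofReal (r ^ e * infDist x E ^ (-(s + e))) ∂μ ≤
        K * ENNReal.ofReal (r ^ (-s)) * μ (closedBall y R) := by
    intro e h0 h1
    have h2 : ∀ x, ENNReal.ofReal (r ^ e * infDist x E ^ (-(s + e))) =
        ENNReal.ofReal (r ^ e) * ENNReal.ofReal (infDist x E ^ (-(s + e))) := fun x =>
      ENNReal.ofReal_mul (by positivity)
    simp_rw [h2]
    rw [lintegral_const_mul' _ _ ENNReal.ofReal_ne_top]
    calc ENNReal.ofReal (r ^ e) *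
          ∫⁻ x in closedBall y R ∩ Eᶜ, ENNReal.ofReal (infDist x E ^ (-(s + e))) ∂μ
        ≤ ENNReal.ofReal (r ^ e) * (K * ENNReal.ofReal (R ^ (-(s + e))) * μ (closedBall y R)) := by
          gcongr
          exact hK _ h0 h1 y R hR hy
      _ = K * ENNReal.ofReal (r ^ e * R ^ (-(s + e))) * μ (closedBall y R) := by
          rw [ENNReal.ofReal_mul (by positivity)]
          ring
      _ ≤ _ := by
          refine mul_le_mul_left (mul_le_mul_right (ENNReal.ofReal_le_ofReal ?_) _) _
          calc r ^ e * R ^ (-(s + e)) ≤ r ^ e * r ^ (-(s + e)) :=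
                mul_le_mul_of_nonneg_left (Real.rpow_le_rpow_of_nonpos hr hrR (by linarith))
                  (by positivity)
            _ = r ^ (-s) := by
                rw [← Real.rpow_add hr]
                congr 1
                ring
  rw [setLAverage_eq]
  refine ENNReal.div_le_of_le_mul ?_
  calc ∫⁻ x in closedBall y R, hardyKernel E δ s r x ∂μ
      = ∫⁻ x in closedBall y R ∩ Eᶜ, ENNReal.ofReal
          (((r / infDist x E) ^ δ + (r / infDist x E) ^ (-δ)) * infDist x E ^ (-s)) ∂μ := by
        rw [hardyKernel, lintegral_indicator hEc.measurableSet.compl,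
          Measure.restrict_restrict hEc.measurableSet.compl, inter_comm]
    _ = ∫⁻ x in closedBall y R ∩ Eᶜ, (ENNReal.ofReal (r ^ δ * infDist x E ^ (-(s + δ))) +
          ENNReal.ofReal (r ^ (-δ) * infDist x E ^ (-(s + -δ)))) ∂μ := by
        refine setLIntegral_congr_fun (measurableSet_closedBall.inter hEc.measurableSet.compl)
          fun x hx => ?_
        have hx0 : 0 < infDist x E := (hEc.notMem_iff_infDist_pos hE).1 hx.2
        rw [add_rpow_neg_mul_rpow_eq hr hx0, ENNReal.ofReal_add (by positivity) (by positivity),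
          sub_eq_add_neg]
    _ = (∫⁻ x in closedBall y R ∩ Eᶜ, ENNReal.ofReal (r ^ δ * infDist x E ^ (-(s + δ))) ∂μ) +
          ∫⁻ x in closedBall y R ∩ Eᶜ, ENNReal.ofReal (r ^ (-δ) * infDist x E ^ (-(s + -δ))) ∂μ :=
        lintegral_add_left (ENNReal.measurable_ofReal.comp ((hd.pow_const _).const_mul _)) _
    _ ≤ K * ENNReal.ofReal (r ^ (-s)) * μ (closedBall y R) +
          K * ENNReal.ofReal (r ^ (-s)) * μ (closedBall y R) :=
        add_le_add (hpart δ (by linarith) hs) (hpart (-δ) (by linarith) (by linarith))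
    _ = _ := by ring

/-- On such a ball the distance to `E` is at least half of its value at `y`, and since `r` is below
that value the part with `r^(-δ)` dominates. -/
theorem setLAverage_hardyKernel_le_far [BorelSpace X]
    {E : Set X} {s₁ : ℝ} {δ s r R : ℝ} (hδ : 0 ≤ δ) (hδs : δ ≤ s) (hs : s + δ ≤ s₁) (hr : 0 < r)
    (hrR : r ≤ R) {y : X} (hy : 2 * R < infDist y E) :
    ⨍⁻ x in closedBall y R, hardyKernel E δ s r x ∂μ ≤
      ENNReal.ofReal (2 * 2 ^ s₁ * infDist y E ^ (δ - s)) * ENNReal.ofReal (r ^ (-δ)) := by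
  have hR : 0 < R := hr.trans_le hrR
  set d := infDist y E with hd
  have hd0 : 0 < d := by linarith
  rw [setLAverage_eq]
  refine ENNReal.div_le_of_le_mul ?_
  rw [← setLIntegral_const]
  refine setLIntegral_mono' measurableSet_closedBall fun x hx => ?_
  refine (indicator_le_self _ _ x).trans ?_
  have hx0 : d / 2 ≤ infDist x E := by
    have := infDist_le_infDist_add_dist (s := E) (x := y) (y := x)
    rw [mem_closedBall, dist_comm] at hx
    linarith
  have hx1 : 0 < infDist x E := lt_of_lt_of_le (by positivity) hx0
  rw [← ENNReal.ofReal_mul (by positivity), add_rpow_neg_mul_rpow_eq hr hx1]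
  refine ENNReal.ofReal_le_ofReal ?_
  have hpow : ∀ e : ℝ, 0 ≤ e → e ≤ s₁ → infDist x E ^ (-e) ≤ 2 ^ s₁ * d ^ (-e) := by
    intro e he hes
    calc infDist x E ^ (-e) ≤ (d / 2) ^ (-e) :=
          Real.rpow_le_rpow_of_nonpos (by positivity) hx0 (by linarith)
      _ = 2 ^ e * d ^ (-e) := by
          rw [Real.div_rpow hd0.le (by norm_num), Real.rpow_neg (x := 2) (by norm_num),
            div_inv_eq_mul, mul_comm]
      _ ≤ 2 ^ s₁ * d ^ (-e) := by
          gcongr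
          norm_num
  have hrd : r ^ δ * d ^ (-(s + δ)) ≤ r ^ (-δ) * d ^ (-(s - δ)) := by
    calc r ^ δ * d ^ (-(s + δ)) = r ^ (-δ) * d ^ (-(s + δ)) * r ^ (2 * δ) := by
          rw [show δ = -δ + 2 * δ by ring, Real.rpow_add hr]
          ring_nf
      _ ≤ r ^ (-δ) * d ^ (-(s + δ)) * d ^ (2 * δ) := by
          gcongr
          linarith
      _ = _ := by
          rw [mul_assoc, ← Real.rpow_add hd0]
          congr 2
          ring
  calc r ^ δ * infDist x E ^ (-(s + δ)) + r ^ (-δ) * infDist x E ^ (-(s - δ))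
      ≤ r ^ δ * (2 ^ s₁ * d ^ (-(s + δ))) + r ^ (-δ) * (2 ^ s₁ * d ^ (-(s - δ))) := by
        gcongr
        · exact hpow _ (by linarith) hs
        · exact hpow _ (by linarith) (by linarith)
    _ = 2 ^ s₁ * (r ^ δ * d ^ (-(s + δ)) + r ^ (-δ) * d ^ (-(s - δ))) := by ring
    _ ≤ 2 ^ s₁ * (r ^ (-δ) * d ^ (-(s - δ)) + r ^ (-δ) * d ^ (-(s - δ))) := by gcongr
    _ = _ := by
        rw [neg_sub]
        ring

/-- Scales with `2 * lam * 2^m ≥ d` contribute multiples of `2^(mβ)`, summable because `β < 0`; the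
others contribute `2^(m(q-δ)) * d^(δ-(q-β))`, summable because `δ < q`. Both sums are of order
`d^β`, and `K'` does not depend on `β`. -/
theorem tsum_setLAverage_hardyKernel_le [BorelSpace X]
    {E : Set X} (hE : E.Nonempty) (hEc : IsClosed E) {s₁ : ℝ} {K : ℝ≥0}
    (hK : ∀ s, 0 ≤ s → s ≤ s₁ → ∀ (y : X) (R : ℝ), 0 < R → infDist y E ≤ 2 * R →
      ∫⁻ x in closedBall y R ∩ Eᶜ, ENNReal.ofReal (infDist x E ^ (-s)) ∂μ ≤
        K * ENNReal.ofReal (R ^ (-s)) * μ (closedBall y R))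
    {q δ lam : ℝ} (hδ : 0 < δ) (hδq : δ < q) (hlam : 1 ≤ lam) :
    ∃ K' : ℝ≥0, ∀ β < 0, q - β + δ ≤ s₁ → ∀ y ∈ Eᶜ,
      ∑' m : ℤ, ENNReal.ofReal (((2 : ℝ) ^ m) ^ q) *
          ⨍⁻ x in closedBall y (lam * 2 ^ m), hardyKernel E δ (q - β) (2 ^ m) x ∂μ ≤
        K' * ENNReal.ofReal (1 - 2 ^ β)⁻¹ * ENNReal.ofReal (infDist y E ^ β) := by
  set c₁ : ℝ := 2 * K * (2 * lam) ^ s₁ with hc₁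
  set c₂ : ℝ := 2 * 2 ^ s₁ * (1 - 2 ^ (-(q - δ)))⁻¹ with hc₂
  have h2δ : (2 : ℝ) ^ (-(q - δ)) < 1 :=
    Real.rpow_lt_one_of_one_lt_of_neg one_lt_two (by linarith)
  have hc₂0 : 0 ≤ c₂ := by
    have : 0 < (1 - (2 : ℝ) ^ (-(q - δ)))⁻¹ := inv_pos.2 (by linarith)
    positivity
  refine ⟨(c₁ + c₂).toNNReal, fun β hβ hs y hy => ?_⟩
  set d := infDist y E with hd
  have hd0 : 0 < d := (hEc.notMem_iff_infDist_pos hE).1 hy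
  have h2β : (2 : ℝ) ^ β < 1 := Real.rpow_lt_one_of_one_lt_of_neg one_lt_two hβ
  have hterm : ∀ m : ℤ, ENNReal.ofReal (((2 : ℝ) ^ m) ^ q) *
        ⨍⁻ x in closedBall y (lam * 2 ^ m), hardyKernel E δ (q - β) (2 ^ m) x ∂μ ≤
      2 * K * (if d / (2 * lam) ≤ (2 : ℝ) ^ m then
        ENNReal.ofReal (((2 : ℝ) ^ m) ^ (-(-β))) else 0) +
      ENNReal.ofReal (2 * 2 ^ s₁ * d ^ (δ - (q - β))) * (if (2 : ℝ) ^ m < d / (2 * lam) then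
        ENNReal.ofReal (((2 : ℝ) ^ m) ^ (q - δ)) else 0) := by
    intro m
    have hr : (0 : ℝ) < 2 ^ m := by positivity
    have hrR : (2 : ℝ) ^ m ≤ lam * 2 ^ m := le_mul_of_one_le_left hr.le hlam
    by_cases hm : d / (2 * lam) ≤ (2 : ℝ) ^ m
    · rw [if_pos hm, if_neg (not_lt.2 hm), mul_zero, add_zero]
      rw [div_le_iff₀ (by positivity)] at hm
      have h1 := setLAverage_hardyKernel_le_near hE hEc hK hδ.le (s := q - β) (by linarith)
        hs hr hrR (y := y) (by linarith)
      refine (mul_le_mul_right h1 _).trans (le_of_eq ?_)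
      rw [mul_left_comm, ← ENNReal.ofReal_mul (by positivity), ← Real.rpow_add hr]
      congr 3
      ring
    · rw [if_neg hm, if_pos (not_le.1 hm), mul_zero, zero_add]
      rw [not_le, lt_div_iff₀ (by positivity)] at hm
      have h1 := setLAverage_hardyKernel_le_far (μ := μ) hδ.le (s := q - β) (by linarith)
        hs hr hrR (y := y) (by linarith)
      refine (mul_le_mul_right h1 _).trans (le_of_eq ?_)
      rw [mul_left_comm, ← ENNReal.ofReal_mul (by positivity), ← Real.rpow_add hr,
        ← sub_eq_add_neg]
  have hdl : 0 < d / (2 * lam) := by positivity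
  -- The small scales do not produce this factor; it is inserted to give both parts the same form.
  have hI : 1 ≤ (1 - (2 : ℝ) ^ β)⁻¹ := by
    refine (one_le_inv₀ (by linarith)).2 ?_
    have : (0 : ℝ) < 2 ^ β := by positivity
    linarith
  have hreal₁ : 2 * K * ((d / (2 * lam)) ^ (-(-β)) * (1 - 2 ^ (-(-β)))⁻¹) ≤
      c₁ * (1 - (2 : ℝ) ^ β)⁻¹ * d ^ β := by
    rw [neg_neg, Real.div_rpow hd0.le (by positivity), div_eq_mul_inv,
      ← Real.rpow_neg (by positivity)]
    calc 2 * K * (d ^ β * (2 * lam) ^ (-β) * (1 - (2 : ℝ) ^ β)⁻¹)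
        ≤ 2 * K * (d ^ β * (2 * lam) ^ s₁ * (1 - (2 : ℝ) ^ β)⁻¹) := by
          gcongr
          · linarith
          · linarith
      _ = _ := by rw [hc₁]; ring
  have hreal₂ : 2 * 2 ^ s₁ * d ^ (δ - (q - β)) *
      ((d / (2 * lam)) ^ (q - δ) * (1 - 2 ^ (-(q - δ)))⁻¹) ≤
      c₂ * (1 - (2 : ℝ) ^ β)⁻¹ * d ^ β := by
    have h3 : (d / (2 * lam)) ^ (q - δ) ≤ d ^ (q - δ) := by
      refine Real.rpow_le_rpow hdl.le ?_ (by linarith)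
      exact div_le_self hd0.le (by linarith)
    have h4 : 0 < (1 - (2 : ℝ) ^ (-(q - δ)))⁻¹ := inv_pos.2 (by linarith)
    calc 2 * 2 ^ s₁ * d ^ (δ - (q - β)) *
          ((d / (2 * lam)) ^ (q - δ) * (1 - 2 ^ (-(q - δ)))⁻¹)
        ≤ 2 * 2 ^ s₁ * d ^ (δ - (q - β)) * (d ^ (q - δ) * (1 - 2 ^ (-(q - δ)))⁻¹) := by
          gcongr
      _ = c₂ * 1 * (d ^ (δ - (q - β)) * d ^ (q - δ)) := by rw [hc₂]; ring
      _ = c₂ * 1 * d ^ β := by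
          rw [← Real.rpow_add hd0]
          congr 2
          ring
      _ ≤ _ := by gcongr
  calc _ ≤ _ := ENNReal.tsum_le_tsum hterm
    _ = _ := ENNReal.tsum_add
    _ ≤ 2 * K * ENNReal.ofReal ((d / (2 * lam)) ^ (-(-β)) * (1 - 2 ^ (-(-β)))⁻¹) +
        ENNReal.ofReal (2 * 2 ^ s₁ * d ^ (δ - (q - β))) *
          ENNReal.ofReal ((d / (2 * lam)) ^ (q - δ) * (1 - 2 ^ (-(q - δ)))⁻¹) := by
        rw [ENNReal.tsum_mul_left, ENNReal.tsum_mul_left]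
        gcongr
        · exact tsum_zpow_rpow_neg_le (by linarith) hdl
        · exact tsum_zpow_rpow_le (by linarith) hdl
    _ = ENNReal.ofReal (2 * K * ((d / (2 * lam)) ^ (-(-β)) * (1 - 2 ^ (-(-β)))⁻¹)) +
        ENNReal.ofReal (2 * 2 ^ s₁ * d ^ (δ - (q - β)) *
          ((d / (2 * lam)) ^ (q - δ) * (1 - 2 ^ (-(q - δ)))⁻¹)) := by
        have h2K : (2 * K : ℝ≥0∞) = ENNReal.ofReal (2 * K) := by
          rw [ENNReal.ofReal_mul zero_le_two, ENNReal.ofReal_coe_nnreal, ENNReal.ofReal_ofNat]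
        rw [h2K, ← ENNReal.ofReal_mul (by positivity), ← ENNReal.ofReal_mul (by positivity)]
    _ ≤ ENNReal.ofReal (c₁ * (1 - (2 : ℝ) ^ β)⁻¹ * d ^ β) +
        ENNReal.ofReal (c₂ * (1 - (2 : ℝ) ^ β)⁻¹ * d ^ β) :=
        add_le_add (ENNReal.ofReal_le_ofReal hreal₁) (ENNReal.ofReal_le_ofReal hreal₂)
    _ = _ := by
        have hc₁0 : 0 ≤ c₁ := by positivity
        have hI0 : 0 ≤ (1 - (2 : ℝ) ^ β)⁻¹ := by linarith
        rw [← ENNReal.ofReal_add (by positivity) (by positivity), ← add_mul, ← add_mul,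
          ENNReal.ofReal_mul (by positivity), ENNReal.ofReal_mul (by positivity)]
        rfl

end Kernel

/-! ### Hardy inequalities for functions vanishing near the complement -/

section Hardy

variable {X : Type*} [MetricSpace X] [MeasurableSpace X] {μ : Measure X} {D : ℝ≥0}

/-- Bounded continuous functions with bounded support at a positive distance from `E`. -/
structure IsHardyTestFunction (E : Set X) (v : X → ℝ) : Prop where
  continuous : Continuous v
  bounded : ∃ M, ∀ x, |v x| ≤ M
  isBounded_support : Bornology.IsBounded {x | v x ≠ 0}
  away : ∃ ε > 0, ∀ x, v x ≠ 0 → ε ≤ infDist x E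

/-- The `(q, β)`-Hardy inequality outside `E` with constant `C` for the test functions that vanish
near `E`, where the upper gradients are those on the whole space. -/
def HardyAwayFrom (μ : Measure X) (E : Set X) (q β : ℝ) (C : ℝ≥0) : Prop :=
  ∀ (v : X → ℝ) (h : X → ℝ≥0∞), IsHardyTestFunction E v → IsUpperGradientOn h v univ →
    ∫⁻ x in Eᶜ, ‖v x‖ₑ ^ q * ENNReal.ofReal (infDist x E ^ (β - q)) ∂μ ≤
      C * ∫⁻ x in Eᶜ, h x ^ q * ENNReal.ofReal (infDist x E ^ β) ∂μ

/-- Finiteness of the left side is what permits absorbing it when `β = 0` and dividing by a power of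
it when `β > 0`. -/
theorem IsHardyTestFunction.lintegral_ne_top [BorelSpace X]
    (hball : ∀ (x : X) (r : ℝ), 0 < r → 0 < μ (closedBall x r) ∧ μ (closedBall x r) < ∞)
    {E : Set X} {v : X → ℝ} (hv : IsHardyTestFunction E v) {q s : ℝ} (hq : 0 < q) (hs : 0 ≤ s) :
    ∫⁻ x in Eᶜ, ‖v x‖ₑ ^ q * ENNReal.ofReal (infDist x E ^ (-s)) ∂μ ≠ ∞ := by
  rcases isEmpty_or_nonempty X with hX | ⟨⟨x₀⟩⟩
  · rw [Measure.eq_zero_of_isEmpty μ]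
    simp
  obtain ⟨M, hM⟩ := hv.bounded
  obtain ⟨ε, hε, hε'⟩ := hv.away
  obtain ⟨R, hR⟩ := (isBounded_iff_subset_closedBall x₀).1 hv.isBounded_support
  have hfin : μ (closedBall x₀ R) < ∞ :=
    (measure_mono (closedBall_subset_closedBall (le_max_left R 1))).trans_lt
      (hball x₀ (max R 1) (by positivity)).2
  refine ne_top_of_le_ne_top (b := ENNReal.ofReal M ^ q * ENNReal.ofReal (ε ^ (-s)) *
    μ (closedBall x₀ R)) (ENNReal.mul_ne_top (ENNReal.mul_ne_top
      (ENNReal.rpow_ne_top_of_nonneg hq.le ENNReal.ofReal_ne_top) ENNReal.ofReal_ne_top)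
      hfin.ne) ?_
  rw [← setLIntegral_const, ← lintegral_indicator measurableSet_closedBall]
  refine (setLIntegral_le_lintegral _ _).trans (lintegral_mono fun x => ?_)
  by_cases hx : v x = 0
  · simp [hx, ENNReal.zero_rpow_of_pos hq]
  · rw [indicator_of_mem (hR hx)]
    refine mul_le_mul' ?_
      (ENNReal.ofReal_le_ofReal (Real.rpow_le_rpow_of_nonpos hε (hε' x hx) (by linarith)))
    gcongr
    rw [Real.enorm_eq_ofReal_abs]
    exact ENNReal.ofReal_le_ofReal (hM x)

/-- The Hardy inequality for negative `β`, with control of the constant as `β → 0`. -/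
theorem exists_hardyAwayFrom_of_neg [BorelSpace X]
    (hball : ∀ (x : X) (r : ℝ), 0 < r → 0 < μ (closedBall x r) ∧ μ (closedBall x r) < ∞)
    (hD : ∀ (x : X) (r : ℝ), 0 < r → μ (closedBall x (2 * r)) ≤ D * μ (closedBall x r))
    (hunbounded : ¬ Bornology.IsBounded (univ : Set X))
    {E : Set X} (hE : E.Nonempty) (hEc : IsClosed E) {t : ℝ} {C : ℝ≥0}
    (hcodim : ∀ z ∈ E, ∀ r R : ℝ, 0 < r → r < R →
      μ (thickening r E ∩ closedBall z R) / μ (closedBall z R) ≤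
        (C : ℝ≥0∞) * ENNReal.ofReal ((r / R) ^ t))
    {q δ s₁ : ℝ} (hP : SupportsPoincare μ q) (hδ : 0 < δ) (hδq : δ < q) (hs₁ : 0 ≤ s₁)
    (hst : s₁ < t) :
    ∃ K : ℝ≥0, ∀ β < 0, q - β + δ ≤ s₁ →
      HardyAwayFrom μ E q β (K * (1 - 2 ^ β : ℝ)⁻¹.toNNReal) := by
  have := sigmaFinite_of_measure_closedBall_lt_top hball
  have := secondCountableTopology_of_measure_closedBall hball
  have hq : 0 < q := hδ.trans hδq
  obtain ⟨K₁, hK₁⟩ := exists_lintegral_infDist_rpow_le hball hD hE hEc hcodim hs₁ hst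
  obtain ⟨K₀, lam, hlam, hK₀⟩ := hP.exists_enorm_le_tsum hball hD hunbounded
  obtain ⟨K₂, hK₂⟩ := tsum_setLAverage_hardyKernel_le hE hEc hK₁ hδ hδq hlam
  -- The constant of `tsum_rpow_le_tsum_scale` for `θ = δ / q`, so that the weights there have
  -- exponents `±δ`.
  set W : ℝ≥0 := (2 * (1 - 2 ^ (-(δ / q))) ⁻¹ : ℝ).toNNReal with hW
  refine ⟨K₀ ^ q * W ^ q * D * K₂, fun β hβ hs v h hv hh => ?_⟩
  set h' : X → ℝ≥0∞ := {x | v x ≠ 0}.indicator h with hh'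
  have hh'u : IsUpperGradientOn h' v univ := hh.indicator_ne_zero hv.continuous
  set H : X → ℝ≥0∞ := fun x => h' x ^ q with hH
  have hHm : Measurable H := hh'u.1.pow_const q
  have hH0 : ∀ y ∈ E, H y = 0 := by
    intro y hy
    obtain ⟨ε, hε, hε'⟩ := hv.away
    have hvy : v y = 0 := by
      by_contra h0
      have := hε' y h0
      rw [infDist_zero_of_mem hy] at this
      linarith
    have : h' y = 0 := indicator_of_notMem (s := {x | v x ≠ 0}) (by simpa using hvy) h
    simp only [hH, this, ENNReal.zero_rpow_of_pos hq]
  set k : ℤ → X → ℝ≥0∞ := fun m => hardyKernel E δ (q - β) (2 ^ m) with hk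
  have hkm : ∀ m, Measurable (k m) := fun m => measurable_hardyKernel hEc _ _ _
  have hR : ∀ m : ℤ, 0 < lam * (2 : ℝ) ^ m := fun m => by positivity
  set A : ℝ≥0∞ := K₀ ^ q * W ^ q with hA
  have hAtop : A ≠ ∞ := ENNReal.mul_ne_top
    (ENNReal.rpow_ne_top_of_nonneg hq.le ENNReal.coe_ne_top)
    (ENNReal.rpow_ne_top_of_nonneg hq.le ENNReal.coe_ne_top)
  -- The scale weights multiplied by `d^(β-q)` are exactly `hardyKernel` with `s = q - β`.
  have hpoint : ∀ x ∈ Eᶜ, ‖v x‖ₑ ^ q * ENNReal.ofReal (infDist x E ^ (β - q)) ≤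
      A * ∑' m : ℤ, ENNReal.ofReal (((2 : ℝ) ^ m) ^ q) *
        (k m x * ⨍⁻ y in closedBall x (lam * 2 ^ m), H y ∂μ) := by
    intro x hx
    have hd : 0 < infDist x E := (hEc.notMem_iff_infDist_pos hE).1 hx
    have h1 := hK₀ v h' hv.continuous hv.bounded hv.isBounded_support hh'u x
    have h2 := tsum_rpow_le_tsum_scale hq (div_pos hδ hq) hd
      (fun m : ℤ => ENNReal.ofReal ((2 : ℝ) ^ m) *
        (⨍⁻ y in closedBall x (lam * 2 ^ m), h' y ^ q ∂μ) ^ (1 / q))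
    rw [div_mul_cancel₀ δ hq.ne'] at h2
    calc ‖v x‖ₑ ^ q * ENNReal.ofReal (infDist x E ^ (β - q))
        ≤ (K₀ * ∑' m : ℤ, ENNReal.ofReal ((2 : ℝ) ^ m) *
            (⨍⁻ y in closedBall x (lam * 2 ^ m), h' y ^ q ∂μ) ^ (1 / q)) ^ q *
            ENNReal.ofReal (infDist x E ^ (β - q)) := by gcongr
      _ ≤ (K₀ ^ q * (W ^ q * ∑' m : ℤ, ENNReal.ofReal (((2 : ℝ) ^ m / infDist x E) ^ δ +
            ((2 : ℝ) ^ m / infDist x E) ^ (-δ)) * (ENNReal.ofReal ((2 : ℝ) ^ m) *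
            (⨍⁻ y in closedBall x (lam * 2 ^ m), h' y ^ q ∂μ) ^ (1 / q)) ^ q)) *
            ENNReal.ofReal (infDist x E ^ (β - q)) := by
          rw [ENNReal.mul_rpow_of_nonneg _ _ hq.le]
          gcongr
          exact h2
      _ = A * ∑' m : ℤ, (ENNReal.ofReal (((2 : ℝ) ^ m / infDist x E) ^ δ +
            ((2 : ℝ) ^ m / infDist x E) ^ (-δ)) * (ENNReal.ofReal ((2 : ℝ) ^ m) *
            (⨍⁻ y in closedBall x (lam * 2 ^ m), h' y ^ q ∂μ) ^ (1 / q)) ^ q) *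
            ENNReal.ofReal (infDist x E ^ (β - q)) := by
          rw [ENNReal.tsum_mul_right, hA]
          ring
      _ = _ := by
          congr 1
          refine tsum_congr fun m => ?_
          simp only [hk, hardyKernel, indicator_of_mem hx, hH]
          rw [ENNReal.mul_rpow_of_nonneg _ _ hq.le, ← ENNReal.rpow_mul,
            one_div_mul_cancel hq.ne', ENNReal.rpow_one,
            ENNReal.ofReal_rpow_of_nonneg (by positivity) hq.le,
            ENNReal.ofReal_mul (by positivity), neg_sub]
          ring
  calc ∫⁻ x in Eᶜ, ‖v x‖ₑ ^ q * ENNReal.ofReal (infDist x E ^ (β - q)) ∂μ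
      ≤ ∫⁻ x in Eᶜ, A * ∑' m : ℤ, ENNReal.ofReal (((2 : ℝ) ^ m) ^ q) *
        (k m x * ⨍⁻ y in closedBall x (lam * 2 ^ m), H y ∂μ) ∂μ :=
        setLIntegral_mono' hEc.measurableSet.compl hpoint
    _ ≤ ∫⁻ x, A * ∑' m : ℤ, ENNReal.ofReal (((2 : ℝ) ^ m) ^ q) *
        (k m x * ⨍⁻ y in closedBall x (lam * 2 ^ m), H y ∂μ) ∂μ := setLIntegral_le_lintegral _ _
    _ = A * ∑' m : ℤ, ENNReal.ofReal (((2 : ℝ) ^ m) ^ q) *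
        ∫⁻ x, k m x * ⨍⁻ y in closedBall x (lam * 2 ^ m), H y ∂μ ∂μ := by
        have hm : ∀ m : ℤ, Measurable fun x => ENNReal.ofReal (((2 : ℝ) ^ m) ^ q) *
            (k m x * ⨍⁻ y in closedBall x (lam * 2 ^ m), H y ∂μ) := fun m =>
          ((hkm m).mul (measurable_laverage_closedBall hHm _)).const_mul _
        rw [lintegral_const_mul' _ _ hAtop, lintegral_tsum fun m => (hm m).aemeasurable]
        congr 1
        refine tsum_congr fun m => lintegral_const_mul' _ _ ENNReal.ofReal_ne_top
    _ ≤ A * ∑' m : ℤ, ENNReal.ofReal (((2 : ℝ) ^ m) ^ q) *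
        (D * ∫⁻ y, H y * ⨍⁻ x in closedBall y (lam * 2 ^ m), k m x ∂μ ∂μ) := by
        gcongr with m
        exact lintegral_mul_laverage_le hball hD (hkm m) hHm (hR m)
    _ = A * D * ∫⁻ y, H y * ∑' m : ℤ, ENNReal.ofReal (((2 : ℝ) ^ m) ^ q) *
        ⨍⁻ x in closedBall y (lam * 2 ^ m), k m x ∂μ ∂μ := by
        have e1 : ∀ y, H y * ∑' m : ℤ, ENNReal.ofReal (((2 : ℝ) ^ m) ^ q) *
            ⨍⁻ x in closedBall y (lam * 2 ^ m), k m x ∂μ =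
            ∑' m : ℤ, ENNReal.ofReal (((2 : ℝ) ^ m) ^ q) *
              (H y * ⨍⁻ x in closedBall y (lam * 2 ^ m), k m x ∂μ) := by
          intro y
          rw [← ENNReal.tsum_mul_left]
          exact tsum_congr fun m => by ring
        simp_rw [e1]
        have hm : ∀ m : ℤ, Measurable fun y => ENNReal.ofReal (((2 : ℝ) ^ m) ^ q) *
            (H y * ⨍⁻ x in closedBall y (lam * 2 ^ m), k m x ∂μ) := fun m =>
          (hHm.mul (measurable_laverage_closedBall (hkm m) _)).const_mul _
        rw [lintegral_tsum fun m => (hm m).aemeasurable, mul_assoc A,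
          ← ENNReal.tsum_mul_left (a := (D : ℝ≥0∞))]
        congr 1
        refine tsum_congr fun m => ?_
        rw [lintegral_const_mul' _ _ ENNReal.ofReal_ne_top]
        ring
    _ ≤ A * D * ∫⁻ y, K₂ * ENNReal.ofReal (1 - 2 ^ β)⁻¹ *
          (H y * Eᶜ.indicator (fun y => ENNReal.ofReal (infDist y E ^ β)) y) ∂μ := by
        refine mul_le_mul_right (lintegral_mono fun y => ?_) _
        by_cases hy : y ∈ E
        · rw [hH0 y hy, zero_mul]
          exact zero_le
        · rw [indicator_of_mem (by exact hy)]
          refine (mul_le_mul_right (hK₂ β hβ hs y hy) _).trans (le_of_eq ?_)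
          ring
    _ = A * D * (K₂ * ENNReal.ofReal (1 - 2 ^ β)⁻¹ *
          ∫⁻ y in Eᶜ, H y * ENNReal.ofReal (infDist y E ^ β) ∂μ) := by
        rw [lintegral_const_mul' _ _ (ENNReal.mul_ne_top ENNReal.coe_ne_top ENNReal.ofReal_ne_top),
          ← lintegral_indicator hEc.measurableSet.compl]
        congr 3
        ext y
        by_cases hy : y ∈ Eᶜ <;> simp [hy]
    _ ≤ A * D * (K₂ * ENNReal.ofReal (1 - 2 ^ β)⁻¹ *
          ∫⁻ y in Eᶜ, h y ^ q * ENNReal.ofReal (infDist y E ^ β) ∂μ) := by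
        refine mul_le_mul_right (mul_le_mul_right (lintegral_mono fun y => ?_) _) _
        exact mul_le_mul_left (ENNReal.rpow_le_rpow (indicator_le_self _ _ y) hq.le) _
    _ = _ := by
        rw [hA]
        push_cast
        rw [ENNReal.coe_rpow_of_nonneg _ hq.le, ENNReal.coe_rpow_of_nonneg _ hq.le]
        simp only [ENNReal.ofReal]
        ring

/-- Bernoulli's inequality for `(1 - 1/2)^ε`. It shows that the Hardy constant for `β = -ε` grows no
faster than `1/ε`. -/
theorem one_sub_two_rpow_neg_inv_le {ε : ℝ} (hε : 0 < ε) (hε1 : ε ≤ 1) :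
    (1 - (2 : ℝ) ^ (-ε))⁻¹ ≤ 2 / ε := by
  have h := rpow_one_add_le_one_add_mul_self (s := -(1 / 2)) (by norm_num) hε.le hε1
  have h2 : (2 : ℝ) ^ (-ε) = (1 + -(1 / 2)) ^ ε := by
    rw [Real.rpow_neg (by norm_num), ← Real.inv_rpow (by norm_num)]
    norm_num
  rw [h2, show 2 / ε = (ε / 2)⁻¹ by rw [inv_div]]
  exact inv_anti₀ (by positivity) (by linarith)

theorem IsHardyTestFunction.mul_infDist_rpow {X : Type*} [MetricSpace X] {E : Set X} {v : X → ℝ}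
    (hv : IsHardyTestFunction E v) {θ : ℝ} (hθ : 0 < θ) :
    IsHardyTestFunction E fun x => v x * infDist x E ^ θ := by
  obtain ⟨M, hM⟩ := hv.bounded
  obtain ⟨ε, hε, hε'⟩ := hv.away
  have hne : ∀ x, v x * infDist x E ^ θ ≠ 0 → v x ≠ 0 := fun x hx h0 => hx (by rw [h0, zero_mul])
  refine ⟨hv.continuous.mul ((continuous_infDist_pt E).rpow_const fun x => Or.inr hθ.le), ?_,
    hv.isBounded_support.subset fun x hx => hne x hx, ε, hε, fun x hx => hε' x (hne x hx)⟩
  rcases isEmpty_or_nonempty X with hX | ⟨⟨x₀⟩⟩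
  · exact ⟨0, fun x => (hX.false x).elim⟩
  obtain ⟨R, hR⟩ := (isBounded_iff_subset_closedBall x₀).1 hv.isBounded_support
  have hM0 : 0 ≤ M := (abs_nonneg _).trans (hM x₀)
  refine ⟨M * (infDist x₀ E + |R|) ^ θ, fun x => ?_⟩
  have hd0 : 0 ≤ infDist x₀ E := infDist_nonneg
  by_cases hx : v x = 0
  · rw [hx, zero_mul, abs_zero]
    positivity
  · have h1 : dist x x₀ ≤ R := hR hx
    have h2 := infDist_le_infDist_add_dist (s := E) (x := x) (y := x₀)
    rw [abs_mul, abs_of_nonneg (Real.rpow_nonneg infDist_nonneg _)]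
    exact mul_le_mul (hM x) (Real.rpow_le_rpow infDist_nonneg
      (by linarith [le_abs_self R]) hθ.le) (Real.rpow_nonneg infDist_nonneg _) hM0

/-- The unweighted Hardy inequality. -/
theorem exists_hardyAwayFrom_zero [BorelSpace X]
    (hball : ∀ (x : X) (r : ℝ), 0 < r → 0 < μ (closedBall x r) ∧ μ (closedBall x r) < ∞)
    (hD : ∀ (x : X) (r : ℝ), 0 < r → μ (closedBall x (2 * r)) ≤ D * μ (closedBall x r))
    (hunbounded : ¬ Bornology.IsBounded (univ : Set X))
    {E : Set X} (hE : E.Nonempty) (hEc : IsClosed E) {t : ℝ} {C : ℝ≥0}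
    (hcodim : ∀ z ∈ E, ∀ r R : ℝ, 0 < r → r < R →
      μ (thickening r E ∩ closedBall z R) / μ (closedBall z R) ≤
        (C : ℝ≥0∞) * ENNReal.ofReal ((r / R) ^ t))
    {q : ℝ} (hP : SupportsPoincare μ q) (hq : 1 < q) (hqt : q < t) :
    ∃ K : ℝ≥0, HardyAwayFrom μ E q 0 K := by
  have hq0 : 0 < q := by linarith
  set δ : ℝ := min ((t - q) / 4) (q / 2) with hδdef
  have hδ : 0 < δ := lt_min (by linarith) (by linarith)
  have hδ1 : δ ≤ (t - q) / 4 := min_le_left _ _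
  have hδq : δ < q := (min_le_right _ _).trans_lt (by linarith)
  obtain ⟨K, hK⟩ := exists_hardyAwayFrom_of_neg hball hD hunbounded hE hEc hcodim hP hδ hδq
    (s₁ := (q + t) / 2) (by linarith) (by linarith)
  set L : ℝ := 2 * (K * 2 ^ q + 1) with hL
  have hL0 : 0 < L := by positivity
  -- The bound `1` serves Bernoulli's inequality, `(t - q) / 4` keeps `q + ε + δ ≤ s₁`, and the last
  -- term makes `K * 2^q * ε^(q-1) ≤ 1/2`.
  set ε : ℝ := min 1 (min ((t - q) / 4) ((1 / L) ^ (1 / (q - 1)))) with hεdef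
  have hε : 0 < ε := lt_min one_pos (lt_min (by linarith) (by positivity))
  have hε1 : ε ≤ 1 := min_le_left _ _
  have hε2 : ε ≤ (t - q) / 4 := (min_le_right _ _).trans (min_le_left _ _)
  have hε3 : ε ^ (q - 1) ≤ 1 / L := by
    calc ε ^ (q - 1) ≤ ((1 / L) ^ (1 / (q - 1))) ^ (q - 1) :=
          Real.rpow_le_rpow hε.le ((min_le_right _ _).trans (min_le_right _ _)) (by linarith)
      _ = 1 / L := by
          rw [← Real.rpow_mul (by positivity), one_div_mul_cancel (by linarith), Real.rpow_one]
  set Cε : ℝ≥0 := K * (1 - 2 ^ (-ε) : ℝ)⁻¹.toNNReal with hCε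
  have hH : HardyAwayFrom μ E q (-ε) Cε := hK (-ε) (by linarith) (by linarith)
  -- With this `θ` the factor `(d^θ)^q` cancels the weight `d^(-ε)`.
  set θ : ℝ := ε / q with hθdef
  have hθ : 0 < θ := by positivity
  have hθq : θ * q = ε := div_mul_cancel₀ _ hq0.ne'
  -- The coefficient of the term to be absorbed: `Cε` is of order `1/ε` and `θ^q ≤ ε^q`, so it is at
  -- most a multiple of `ε^(q-1)`, small because `q > 1`.
  have habs : Cε * (2 : ℝ≥0∞) ^ (q - 1) * ENNReal.ofReal (θ ^ q) ≤ 2⁻¹ := by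
    have h1 : (Cε : ℝ≥0∞) * (2 : ℝ≥0∞) ^ (q - 1) * ENNReal.ofReal (θ ^ q) =
        ENNReal.ofReal (K * (1 - (2 : ℝ) ^ (-ε))⁻¹ * 2 ^ (q - 1) * θ ^ q) := by
      have h2 : (2 : ℝ) ^ (-ε) ≤ 1 :=
        Real.rpow_le_one_of_one_le_of_nonpos one_le_two (by linarith)
      have h3 : 0 ≤ (1 - (2 : ℝ) ^ (-ε))⁻¹ := inv_nonneg.2 (by linarith)
      rw [ENNReal.ofReal_mul (by positivity), ENNReal.ofReal_mul (by positivity),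
        ENNReal.ofReal_mul (by positivity), ENNReal.ofReal_coe_nnreal,
        ← ENNReal.ofReal_rpow_of_pos two_pos, ENNReal.ofReal_ofNat, hCε]
      push_cast
      rfl
    have h4 : (K : ℝ) * (1 - (2 : ℝ) ^ (-ε))⁻¹ * 2 ^ (q - 1) * θ ^ q ≤ 2⁻¹ := by
      have hθε : θ ^ q ≤ ε ^ q := by
        gcongr
        exact div_le_self hε.le hq.le
      calc (K : ℝ) * (1 - (2 : ℝ) ^ (-ε))⁻¹ * 2 ^ (q - 1) * θ ^ q
          ≤ K * (2 / ε) * 2 ^ (q - 1) * ε ^ q := by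
            gcongr
            exact one_sub_two_rpow_neg_inv_le hε hε1
        _ = K * (2 * 2 ^ (q - 1)) * (ε ^ q / ε) := by ring
        _ = K * 2 ^ q * ε ^ (q - 1) := by
            rw [Real.rpow_sub_one hε.ne', Real.rpow_sub_one two_ne_zero]
            ring
        _ ≤ K * 2 ^ q * (1 / L) := by gcongr
        _ ≤ 2⁻¹ := by
            rw [mul_one_div, div_le_iff₀ hL0, hL]
            linarith
    rw [h1]
    refine (ENNReal.ofReal_le_ofReal h4).trans (le_of_eq ?_)
    rw [ENNReal.ofReal_inv_of_pos two_pos, ENNReal.ofReal_ofNat]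
  refine ⟨2 * (Cε * 2 ^ (q - 1)), fun v h hv hh => ?_⟩
  have hmain := hH _ _ (hv.mul_infDist_rpow hθ) (hh.mul_rpow hv.continuous (lipschitz_infDist_pt E)
    (fun x => infDist_nonneg) hθ)
  have hdpos : ∀ x ∈ Eᶜ, 0 < infDist x E := fun x hx => (hEc.notMem_iff_infDist_pos hE).1 hx
  have hEm := hEc.measurableSet.compl
  set A := ∫⁻ x in Eᶜ, ‖v x‖ₑ ^ q * ENNReal.ofReal (infDist x E ^ (0 - q)) ∂μ with hA
  set G := ∫⁻ x in Eᶜ, h x ^ q * ENNReal.ofReal (infDist x E ^ (0 : ℝ)) ∂μ with hG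
  have hAfin : A ≠ ∞ := by
    rw [hA, zero_sub]
    exact hv.lintegral_ne_top hball hq0 hq0.le
  have hleft : ∫⁻ x in Eᶜ, ‖v x * infDist x E ^ θ‖ₑ ^ q *
      ENNReal.ofReal (infDist x E ^ (-ε - q)) ∂μ = A := by
    refine setLIntegral_congr_fun hEm fun x hx => ?_
    have hd := hdpos x hx
    rw [enorm_mul, ENNReal.mul_rpow_of_nonneg _ _ hq0.le, Real.enorm_of_nonneg (show 0 ≤ infDist x E ^ θ by positivity),
      ENNReal.ofReal_rpow_of_nonneg (by positivity) hq0.le, mul_assoc,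
      ← ENNReal.ofReal_mul (by positivity), ← Real.rpow_mul hd.le, hθq, ← Real.rpow_add hd]
    congr 3
    ring
  have hright : ∫⁻ x in Eᶜ, (ENNReal.ofReal (infDist x E ^ θ) * h x +
        ‖v x‖ₑ * ENNReal.ofReal (θ * infDist x E ^ (θ - 1))) ^ q *
        ENNReal.ofReal (infDist x E ^ (-ε)) ∂μ ≤
      2 ^ (q - 1) * (G + ENNReal.ofReal (θ ^ q) * A) := by
    have hvm : Measurable fun x => ‖v x‖ₑ ^ q * ENNReal.ofReal (infDist x E ^ (0 - q)) :=
      (hv.continuous.measurable.enorm.pow_const q).mul (ENNReal.measurable_ofReal.comp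
        ((continuous_infDist_pt E).measurable.pow_const _))
    rw [hA, hG, ← lintegral_const_mul _ hvm, ← lintegral_add_right _ (hvm.const_mul _),
      ← lintegral_const_mul' _ _ (ENNReal.rpow_ne_top_of_nonneg (by linarith)
        ENNReal.ofNat_ne_top)]
    refine setLIntegral_mono' hEm fun x hx => ?_
    have hd := hdpos x hx
    refine (mul_le_mul_left (ENNReal.rpow_add_le_mul_rpow_add_rpow _ _ hq.le) _).trans
      (le_of_eq ?_)
    rw [mul_assoc, add_mul]
    congr 2
    · rw [ENNReal.mul_rpow_of_nonneg _ _ hq0.le,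
        ENNReal.ofReal_rpow_of_nonneg (by positivity) hq0.le, ← Real.rpow_mul hd.le, hθq,
        mul_comm (ENNReal.ofReal _), mul_assoc, ← ENNReal.ofReal_mul (by positivity),
        ← Real.rpow_add hd, add_neg_cancel]
    · rw [ENNReal.mul_rpow_of_nonneg _ _ hq0.le,
        ENNReal.ofReal_rpow_of_nonneg (by positivity) hq0.le,
        Real.mul_rpow hθ.le (by positivity), mul_assoc, ← ENNReal.ofReal_mul (by positivity),
        mul_assoc, ← Real.rpow_mul hd.le, ← Real.rpow_add hd,
        ENNReal.ofReal_mul (by positivity), ← mul_assoc, mul_comm (‖v x‖ₑ ^ q), mul_assoc]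
      congr 4
      rw [sub_mul, hθq]
      ring
  rw [hleft] at hmain
  have hfinal : A ≤ Cε * 2 ^ (q - 1) * G + 2⁻¹ * A := by
    calc A ≤ Cε * (2 ^ (q - 1) * (G + ENNReal.ofReal (θ ^ q) * A)) :=
          hmain.trans (mul_le_mul_right hright _)
      _ = Cε * 2 ^ (q - 1) * G + Cε * 2 ^ (q - 1) * ENNReal.ofReal (θ ^ q) * A := by ring
      _ ≤ _ := by gcongr
  have hhalf : A = 2⁻¹ * A + 2⁻¹ * A := by
    rw [← add_mul, ENNReal.inv_two_add_inv_two, one_mul]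
  have hhalf' : 2⁻¹ * A ≤ Cε * 2 ^ (q - 1) * G := by
    refine (ENNReal.add_le_add_iff_right (a := 2⁻¹ * A)
      (ENNReal.mul_ne_top (by simp) hAfin)).1 ?_
    rw [← hhalf]
    exact hfinal
  calc A = 2 * (2⁻¹ * A) := by
        rw [← mul_assoc, ENNReal.mul_inv_cancel two_ne_zero ENNReal.ofNat_ne_top, one_mul]
    _ ≤ 2 * (Cε * 2 ^ (q - 1) * G) := by gcongr
    _ = _ := by
        push_cast
        rw [ENNReal.coe_rpow_of_nonneg _ (by linarith)]
        push_cast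
        ring

theorem IsHardyTestFunction.abs_rpow {X : Type*} [MetricSpace X] {E : Set X} {v : X → ℝ}
    (hv : IsHardyTestFunction E v) {a : ℝ} (ha : 0 < a) : IsHardyTestFunction E fun x => |v x| ^ a := by
  obtain ⟨M, hM⟩ := hv.bounded
  obtain ⟨ε, hε, hε'⟩ := hv.away
  have hne : ∀ x, |v x| ^ a ≠ 0 → v x ≠ 0 := fun x hx h0 =>
    hx (by rw [h0, abs_zero, Real.zero_rpow ha.ne'])
  refine ⟨hv.continuous.abs.rpow_const fun x => Or.inr ha.le, ⟨M ^ a, fun x => ?_⟩,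
    hv.isBounded_support.subset fun x hx => hne x hx, ε, hε, fun x hx => hε' x (hne x hx)⟩
  rw [abs_of_nonneg (by positivity)]
  exact Real.rpow_le_rpow (abs_nonneg _) (hM x) ha.le

/-- The Hardy inequality for positive `β` follows from an unweighted one with a smaller
exponent. -/
theorem HardyAwayFrom.exists_of_pos [BorelSpace X]
    (hball : ∀ (x : X) (r : ℝ), 0 < r → 0 < μ (closedBall x r) ∧ μ (closedBall x r) < ∞)
    {E : Set X} (hE : E.Nonempty) (hEc : IsClosed E) {p β : ℝ} {C : ℝ≥0} (hβ : 0 < β)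
    (hq : 0 < p - β) (hH : HardyAwayFrom μ E (p - β) 0 C) :
    ∃ K : ℝ≥0, HardyAwayFrom μ E p β K := by
  set q : ℝ := p - β with hqdef
  have hp : 0 < p := by linarith
  have hqp : q ≤ p := by linarith
  -- Then `(|v|^a)^q = |v|^p` and `(|v|^(a-1))^q = |v|^β`.
  set a : ℝ := p / q with ha
  have ha1 : 1 ≤ a := (one_le_div hq).2 hqp
  have haq : a * q = p := div_mul_cancel₀ _ hq.ne'
  set C' : ℝ≥0 := C * (a ^ q).toNNReal with hC'
  refine ⟨C' ^ (p / q), fun v h hv hh => ?_⟩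
  have hmain := hH _ _ (hv.abs_rpow (by linarith)) (hh.abs_rpow hv.continuous ha1)
  have hdpos : ∀ x ∈ Eᶜ, 0 < infDist x E := fun x hx => (hEc.notMem_iff_infDist_pos hE).1 hx
  have hEm := hEc.measurableSet.compl
  have hdm : Measurable fun x => infDist x E := (continuous_infDist_pt E).measurable
  set A := ∫⁻ x in Eᶜ, ‖v x‖ₑ ^ p * ENNReal.ofReal (infDist x E ^ (β - p)) ∂μ with hA
  set G := ∫⁻ x in Eᶜ, h x ^ p * ENNReal.ofReal (infDist x E ^ β) ∂μ with hG
  have hAfin : A ≠ ∞ := by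
    rw [hA, ← neg_sub]
    exact hv.lintegral_ne_top hball hp hq.le
  have hleft : ∫⁻ x in Eᶜ, ‖|v x| ^ a‖ₑ ^ q * ENNReal.ofReal (infDist x E ^ (0 - q)) ∂μ = A := by
    refine lintegral_congr fun x => ?_
    rw [Real.enorm_of_nonneg (by positivity), ENNReal.ofReal_rpow_of_nonneg (by positivity) hq.le,
      ← Real.rpow_mul (abs_nonneg _), haq, ← ENNReal.ofReal_rpow_of_nonneg (abs_nonneg _) hp.le,
      ← Real.enorm_eq_ofReal_abs, hqdef, zero_sub, neg_sub]
  -- The powers of `d` cancel in `F₁ * F₂`; they are chosen so that `F₁^(p/β)` and `F₂^(p/q)` are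
  -- the two integrands of the `(p,β)`-inequality.
  set F₁ : X → ℝ≥0∞ := fun x => ‖v x‖ₑ ^ β * ENNReal.ofReal (infDist x E ^ (-(q * β / p))) with hF₁
  set F₂ : X → ℝ≥0∞ := fun x => h x ^ q * ENNReal.ofReal (infDist x E ^ (q * β / p)) with hF₂
  have hright : ∫⁻ x in Eᶜ, (ENNReal.ofReal (a * |v x| ^ (a - 1)) * h x) ^ q *
      ENNReal.ofReal (infDist x E ^ (0 : ℝ)) ∂μ =
      ENNReal.ofReal (a ^ q) * ∫⁻ x in Eᶜ, (F₁ * F₂) x ∂μ := by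
    rw [← lintegral_const_mul' _ _ ENNReal.ofReal_ne_top]
    refine setLIntegral_congr_fun hEm fun x hx => ?_
    have hd := hdpos x hx
    have e1 : (F₁ * F₂) x = ‖v x‖ₑ ^ β * h x ^ q := by
      simp only [hF₁, hF₂, Pi.mul_apply]
      rw [mul_mul_mul_comm, ← ENNReal.ofReal_mul (by positivity), ← Real.rpow_add hd,
        neg_add_cancel, Real.rpow_zero, ENNReal.ofReal_one, mul_one]
    rw [e1, Real.rpow_zero, ENNReal.ofReal_one, mul_one, ENNReal.mul_rpow_of_nonneg _ _ hq.le,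
      ENNReal.ofReal_rpow_of_nonneg (by positivity) hq.le, Real.mul_rpow (by linarith)
      (by positivity), ← Real.rpow_mul (abs_nonneg _), ENNReal.ofReal_mul (by positivity),
      Real.enorm_eq_ofReal_abs, ENNReal.ofReal_rpow_of_nonneg (abs_nonneg _) hβ.le, mul_assoc]
    congr 4
    rw [sub_mul, haq, hqdef]
    ring
  have hconj : (p / β).HolderConjugate (p / q) := by
    rw [Real.holderConjugate_iff]
    refine ⟨(one_lt_div hβ).2 (by linarith), ?_⟩
    rw [inv_div, inv_div, ← add_div, hqdef, add_sub_cancel, div_self hp.ne']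
  have hF₁m : Measurable F₁ := (hv.continuous.measurable.enorm.pow_const β).mul
    (ENNReal.measurable_ofReal.comp (hdm.pow_const _))
  have hF₂m : Measurable F₂ := (hh.1.pow_const q).mul
    (ENNReal.measurable_ofReal.comp (hdm.pow_const _))
  have hholder := ENNReal.lintegral_mul_le_Lp_mul_Lq (μ.restrict Eᶜ) hconj
    hF₁m.aemeasurable hF₂m.aemeasurable
  have hI₁ : ∫⁻ x in Eᶜ, F₁ x ^ (p / β) ∂μ = A := by
    refine setLIntegral_congr_fun hEm fun x hx => ?_
    have hd := hdpos x hx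
    simp only [hF₁]
    rw [ENNReal.mul_rpow_of_nonneg _ _ (by positivity), ← ENNReal.rpow_mul,
      mul_div_cancel₀ _ hβ.ne', ENNReal.ofReal_rpow_of_nonneg (by positivity) (by positivity),
      ← Real.rpow_mul hd.le]
    congr 3
    rw [hqdef]
    field_simp
    ring
  have hI₂ : ∫⁻ x in Eᶜ, F₂ x ^ (p / q) ∂μ = G := by
    refine setLIntegral_congr_fun hEm fun x hx => ?_
    have hd := hdpos x hx
    simp only [hF₂]
    rw [ENNReal.mul_rpow_of_nonneg _ _ (by positivity), ← ENNReal.rpow_mul,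
      mul_div_cancel₀ _ hq.ne', ENNReal.ofReal_rpow_of_nonneg (by positivity) (by positivity),
      ← Real.rpow_mul hd.le]
    congr 3
    field_simp
  rw [hI₁, hI₂, one_div_div, one_div_div] at hholder
  rw [hleft, hright] at hmain
  have hA1 : A ≤ A ^ (β / p) * (C' * G ^ (q / p)) := by
    refine hmain.trans ((mul_le_mul_right (mul_le_mul_right hholder _) _).trans (le_of_eq ?_))
    rw [hC']
    push_cast
    simp only [ENNReal.ofReal]
    ring
  rcases eq_or_ne A 0 with hA0 | hA0
  · rw [hA0]
    exact zero_le
  have hsum : β / p + q / p = 1 := by rw [← add_div, hqdef, add_sub_cancel, div_self hp.ne']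
  have hA2 : A ^ (q / p) ≤ C' * G ^ (q / p) := by
    refine (ENNReal.mul_le_mul_iff_right (a := A ^ (β / p)) ?_ ?_).1 ?_
    · exact (ENNReal.rpow_pos (pos_iff_ne_zero.2 hA0) hAfin).ne'
    · exact ENNReal.rpow_ne_top_of_nonneg (by positivity) hAfin
    · rw [← ENNReal.rpow_add _ _ hA0 hAfin, hsum, ENNReal.rpow_one]
      exact hA1
  have hqp1 : q / p * (p / q) = 1 := by field_simp
  calc A = (A ^ (q / p)) ^ (p / q) := by rw [← ENNReal.rpow_mul, hqp1, ENNReal.rpow_one]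
    _ ≤ (C' * G ^ (q / p)) ^ (p / q) := by gcongr
    _ = _ := by
        rw [ENNReal.mul_rpow_of_nonneg _ _ (by positivity), ← ENNReal.rpow_mul, hqp1,
          ENNReal.rpow_one, ENNReal.coe_rpow_of_nonneg _ (by positivity)]

end Hardy

/-! ### Removal of the vanishing condition -/

section LipschitzTestFunctions

open Filter Topology

variable {X : Type*} [MetricSpace X] [MeasurableSpace X] {μ : Measure X}

theorem IsUpperGradientOn.congr_on {g : X → ℝ≥0∞} {f f' : X → ℝ} {A : Set X}
    (hg : IsUpperGradientOn g f A) (hff' : EqOn f' f A) : IsUpperGradientOn g f' A := by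
  refine ⟨hg.1, fun l γ hl hγ hA => ?_⟩
  rw [hff' (hA ⟨le_rfl, hl⟩), hff' (hA ⟨hl, le_rfl⟩)]
  exact hg.2 l γ hl hγ hA

/-- Functions in `Lip_b(Ω)` are bounded on `Ω`. -/
theorem exists_abs_le_of_mem_LipB {X : Type*} [MetricSpace X] {Ω : Set X} {u : X → ℝ}
    (hu : u ∈ LipB Ω) : ∃ M, 0 ≤ M ∧ ∀ x ∈ Ω, |u x| ≤ M := by
  obtain ⟨⟨L, hL⟩, hb⟩ := hu
  rcases ({x ∈ Ω | u x ≠ 0}).eq_empty_or_nonempty with h0 | ⟨x₀, hx₀⟩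
  · refine ⟨0, le_rfl, fun x hx => ?_⟩
    have : u x = 0 := by
      by_contra hne
      exact (h0 ▸ (⟨hx, hne⟩ : x ∈ {x ∈ Ω | u x ≠ 0}) : x ∈ (∅ : Set X))
    simp [this]
  · refine ⟨|u x₀| + L * diam {x ∈ Ω | u x ≠ 0}, by positivity, fun x hx => ?_⟩
    by_cases hne : u x = 0
    · rw [hne, abs_zero]
      positivity
    · have h1 := hL.dist_le_mul x hx x₀ hx₀.1
      rw [Real.dist_eq] at h1
      have h2 : dist x x₀ ≤ diam {x ∈ Ω | u x ≠ 0} := dist_le_diam_of_mem hb ⟨hx, hne⟩ hx₀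
      have h3 : (L : ℝ) * dist x x₀ ≤ L * diam {x ∈ Ω | u x ≠ 0} := by gcongr
      have h4 := abs_sub_abs_le_abs_sub (u x) (u x₀)
      linarith

/-- The Hardy inequality for test functions vanishing near the complement extends to all
functions in `Lip_b(Ω)` if the codimension of the complement is larger than `p - β`. -/
theorem HardyAwayFrom.lintegral_le_of_mem_LipB [BorelSpace X] {D : ℝ≥0}
    (hball : ∀ (x : X) (r : ℝ), 0 < r → 0 < μ (closedBall x r) ∧ μ (closedBall x r) < ∞)
    (hD : ∀ (x : X) (r : ℝ), 0 < r → μ (closedBall x (2 * r)) ≤ D * μ (closedBall x r))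
    {Ω : Set X} (hΩ : IsOpen Ω) (hE : Ωᶜ.Nonempty) {t : ℝ} {C₀ : ℝ≥0}
    (hcodim : ∀ z ∈ Ωᶜ, ∀ r R : ℝ, 0 < r → r < R →
      μ (thickening r Ωᶜ ∩ closedBall z R) / μ (closedBall z R) ≤
        (C₀ : ℝ≥0∞) * ENNReal.ofReal ((r / R) ^ t))
    {p β : ℝ} (hp : 1 ≤ p) (hβ : β ≤ p) (hpt : p - β < t) {C : ℝ≥0}
    (hH : HardyAwayFrom μ Ωᶜ p β C) {u : X → ℝ} (hu : u ∈ LipB Ω) {g : X → ℝ≥0∞}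
    (hg : IsUpperGradientOn g u Ω) :
    ∫⁻ x in Ω, ‖u x‖ₑ ^ p * ENNReal.ofReal (infDist x Ωᶜ ^ (β - p)) ∂μ ≤
      C * 2 ^ (p - 1) * ∫⁻ x in Ω, g x ^ p * ENNReal.ofReal (infDist x Ωᶜ ^ β) ∂μ := by
  have hp0 : 0 < p := by linarith
  have hEc : IsClosed Ωᶜ := hΩ.isClosed_compl
  set d : X → ℝ := fun x => infDist x Ωᶜ with hd
  have hdlip : LipschitzWith 1 d := lipschitz_infDist_pt _
  have hdc : Continuous d := hdlip.continuous
  have hdpos : ∀ x ∈ Ω, 0 < d x := fun x hx =>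
    (hEc.notMem_iff_infDist_pos hE).1 (not_not.2 hx)
  have hdΩ : ∀ x, 0 < d x → x ∈ Ω := fun x hx =>
    not_not.1 ((hEc.notMem_iff_infDist_pos hE).2 hx)
  obtain ⟨M, hM0, hM⟩ := exists_abs_le_of_mem_LipB hu
  obtain ⟨⟨L, hL⟩, hbdd⟩ := hu
  -- The values of `u` outside `Ω` are arbitrary, possibly non-measurable, so they are replaced by
  -- zero.
  set w : X → ℝ := Ω.indicator u with hw
  have hwu : EqOn w u Ω := fun x hx => indicator_of_mem hx u
  have hwc : ContinuousOn w Ω := hL.continuousOn.congr hwu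
  have hwm : Measurable w := by
    classical
    rw [hw, ← piecewise_eq_indicator]
    exact hL.continuousOn.measurable_piecewise continuousOn_const hΩ.measurableSet
  have hwM : ∀ x, |w x| ≤ M := by
    intro x
    by_cases hx : x ∈ Ω
    · rw [hwu hx]
      exact hM x hx
    · simp only [hw, indicator_of_notMem hx, abs_zero, hM0]
  have hwg : IsUpperGradientOn g w Ω := hg.congr_on hwu
  have hΩm := hΩ.measurableSet
  set F : X → ℝ≥0∞ := fun x => ‖w x‖ₑ ^ p * ENNReal.ofReal (d x ^ (β - p)) with hF
  have hdm : Measurable d := hdc.measurable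
  have hFm : Measurable F := (hwm.enorm.pow_const p).mul
    (ENNReal.measurable_ofReal.comp (hdm.pow_const _))
  have hwsupp : ∀ x, w x ≠ 0 → x ∈ {x ∈ Ω | u x ≠ 0} := by
    intro x hx
    have hxΩ : x ∈ Ω := by
      by_contra hcon
      exact hx (indicator_of_notMem hcon u)
    exact ⟨hxΩ, by rwa [← hwu hxΩ]⟩
  -- This is where codimension larger than `p - β` replaces boundary values: `u` is bounded with
  -- bounded support and `d^(β-p)` is locally integrable up to the boundary.
  have hFint : ∫⁻ x in Ω, F x ∂μ ≠ ∞ := by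
    obtain ⟨x₀, hx₀⟩ := hE
    obtain ⟨R, hR⟩ := (isBounded_iff_subset_closedBall x₀).1 hbdd
    obtain ⟨K, hK⟩ := exists_lintegral_infDist_rpow_le hball hD ⟨x₀, hx₀⟩ hEc hcodim
      (s₁ := p - β) (by linarith) hpt
    have hR1 : 0 < max R 1 := by positivity
    have h1 := hK (p - β) (by linarith) le_rfl x₀ (max R 1) hR1
      (by rw [infDist_zero_of_mem hx₀]; positivity)
    rw [compl_compl, neg_sub] at h1
    have hle : ∫⁻ x in Ω, F x ∂μ ≤ ENNReal.ofReal M ^ p *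
        ∫⁻ x in closedBall x₀ (max R 1) ∩ Ω, ENNReal.ofReal (d x ^ (β - p)) ∂μ := by
      rw [← lintegral_const_mul' _ _ (ENNReal.rpow_ne_top_of_nonneg hp0.le ENNReal.ofReal_ne_top),
        ← Measure.restrict_restrict measurableSet_closedBall,
        ← lintegral_indicator measurableSet_closedBall]
      refine lintegral_mono fun x => ?_
      by_cases hx : w x = 0
      · simp [hF, hx, ENNReal.zero_rpow_of_pos hp0]
      · rw [indicator_of_mem (closedBall_subset_closedBall (le_max_left _ _) (hR (hwsupp x hx)))]
        simp only [hF]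
        gcongr
        rw [Real.enorm_eq_ofReal_abs]
        exact ENNReal.ofReal_le_ofReal (hwM x)
    refine ne_top_of_le_ne_top (ENNReal.mul_ne_top
      (ENNReal.rpow_ne_top_of_nonneg hp0.le ENNReal.ofReal_ne_top)
      (ne_top_of_le_ne_top (ENNReal.mul_ne_top (ENNReal.mul_ne_top ENNReal.coe_ne_top
        ENNReal.ofReal_ne_top) (hball x₀ _ hR1).2.ne) h1)) hle
  set ε : ℕ → ℝ := fun n => 1 / ((n : ℝ) + 1) with hε
  have hεpos : ∀ n, 0 < ε n := fun n => Nat.one_div_pos_of_nat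
  have hεlim : Tendsto ε atTop (𝓝 0) := tendsto_one_div_add_atTop_nhds_zero_nat
  set v : ℕ → X → ℝ := fun n x => w x * distCutoff d (ε n) x with hv
  have hvc : ∀ n, Continuous (v n) := by
    intro n
    rw [continuous_iff_continuousAt]
    intro x
    by_cases hx : x ∈ Ω
    · exact ((hwc x hx).continuousAt (hΩ.mem_nhds hx)).mul
        (continuous_distCutoff hdc _).continuousAt
    · have hx0 : d x < ε n := by
        have : d x = 0 := infDist_zero_of_mem hx
        rw [this]
        exact hεpos n
      have hev : v n =ᶠ[𝓝 x] fun _ => 0 := by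
        filter_upwards [hdc.continuousAt.eventually_lt_const hx0] with y hy
        simp only [hv, distCutoff_eq_zero (hεpos n) hy.le, mul_zero]
      exact continuousAt_const.congr hev.symm
  have hvle : ∀ n x, |v n x| ≤ |w x| := by
    intro n x
    simp only [hv]
    rw [abs_mul, abs_of_nonneg (distCutoff_nonneg _ _ _)]
    exact mul_le_of_le_one_right (abs_nonneg _) (distCutoff_le_one _ _ _)
  have htest : ∀ n, IsHardyTestFunction Ωᶜ (v n) := by
    intro n
    refine ⟨hvc n, ⟨M, fun x => (hvle n x).trans (hwM x)⟩, hbdd.subset fun x hx => ?_, ε n,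
      hεpos n, fun x hx => ?_⟩
    · exact hwsupp x fun h0 => hx (by simp only [hv, h0, zero_mul])
    · by_contra hcon
      have hle : d x ≤ ε n := (not_le.1 hcon).le
      exact hx (by simp only [hv, distCutoff_eq_zero (hεpos n) hle, mul_zero])
  set F' : ℕ → X → ℝ≥0∞ := fun n x => {x | d x < 2 * ε n}.indicator F x with hF'
  have hF'm : ∀ n, Measurable (F' n) := fun n =>
    hFm.indicator (isOpen_lt hdc continuous_const).measurableSet
  have hεev : ∀ x ∈ Ω, ∀ᶠ n in atTop, 2 * ε n < d x := by
    intro x hx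
    have h2 : Tendsto (fun n => 2 * ε n) atTop (𝓝 0) := by simpa using hεlim.const_mul 2
    exact h2.eventually_lt_const (hdpos x hx)
  have hstep : ∀ n, ∫⁻ x in Ω, ‖v n x‖ₑ ^ p * ENNReal.ofReal (d x ^ (β - p)) ∂μ ≤
      C * 2 ^ (p - 1) * ((∫⁻ x in Ω, g x ^ p * ENNReal.ofReal (d x ^ β) ∂μ) +
        2 ^ p * ∫⁻ x in Ω, F' n x ∂μ) := by
    intro n
    have h1 := hH (v n) _ (htest n)
      (hwg.mul_distCutoff hwc hdlip hdΩ hwm (hεpos n) (hvc n))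
    rw [compl_compl] at h1
    refine h1.trans ?_
    rw [mul_assoc (C : ℝ≥0∞)]
    refine mul_le_mul_right ?_ _
    rw [← lintegral_const_mul _ (hF'm n), ← lintegral_add_right _ ((hF'm n).const_mul _),
      ← lintegral_const_mul' _ _ (ENNReal.rpow_ne_top_of_nonneg (by linarith)
        ENNReal.ofNat_ne_top)]
    refine setLIntegral_mono' hΩm fun x hx => ?_
    have hdx := hdpos x hx
    refine (mul_le_mul_left (ENNReal.rpow_add_le_mul_rpow_add_rpow _ _ hp) _).trans ?_
    rw [mul_assoc, add_mul]
    refine mul_le_mul_right (add_le_add le_rfl ?_) _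
    by_cases hxd : d x < 2 * ε n
    · have hmem : x ∈ {x | d x < 2 * ε n} := hxd
      simp only [hF', indicator_of_mem hmem, hF]
      rw [ENNReal.mul_rpow_of_nonneg _ _ hp0.le, mul_left_comm, mul_assoc]
      refine mul_le_mul_right ?_ _
      rw [← ENNReal.ofReal_ofNat, ENNReal.ofReal_rpow_of_nonneg (zero_le_two (α := ℝ)) hp0.le,
        ENNReal.ofReal_rpow_of_nonneg (inv_nonneg.2 (hεpos n).le) hp0.le,
        ← ENNReal.ofReal_mul (Real.rpow_nonneg (inv_nonneg.2 (hεpos n).le) _),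
        ← ENNReal.ofReal_mul (by positivity)]
      refine ENNReal.ofReal_le_ofReal ?_
      -- In the strip `d < 2ε` the slope of the cutoff is at most `2/d`, so the additional gradient
      -- term is bounded by `2^p * F`.
      have h2 : (ε n)⁻¹ ≤ 2 * (d x)⁻¹ := by
        rw [← div_eq_mul_inv, inv_le_comm₀ (hεpos n) (by positivity), inv_div]
        linarith
      calc ((ε n)⁻¹) ^ p * d x ^ β ≤ (2 * (d x)⁻¹) ^ p * d x ^ β := by
            gcongr
        _ = _ := by
            rw [Real.mul_rpow (by norm_num) (by positivity), Real.inv_rpow hdx.le,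
              ← Real.rpow_neg hdx.le, mul_assoc, ← Real.rpow_add hdx]
            congr 2
            ring
    · have hmem : x ∉ {x | d x < 2 * ε n} := hxd
      simp only [indicator_of_notMem hmem, mul_zero, ENNReal.zero_rpow_of_pos hp0, zero_mul]
      exact zero_le
  -- Each point of `Ω` eventually leaves the strips, and `F` is an integrable majorant.
  have hlimF' : Tendsto (fun n => ∫⁻ x in Ω, F' n x ∂μ) atTop (𝓝 0) := by
    have h1 := tendsto_lintegral_of_dominated_convergence (μ := μ.restrict Ω) (F := F')
      (f := fun _ => 0) F hF'm (fun n => ae_of_all _ fun x => indicator_le_self _ _ x) hFint ?_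
    · simpa using h1
    · filter_upwards [ae_restrict_mem hΩm] with x hx
      refine tendsto_const_nhds.congr' ?_
      filter_upwards [hεev x hx] with n hn
      exact (indicator_of_notMem (s := {x | d x < 2 * ε n}) (not_lt.2 hn.le) F).symm
  have hlimv : Tendsto (fun n => ∫⁻ x in Ω, ‖v n x‖ₑ ^ p * ENNReal.ofReal (d x ^ (β - p)) ∂μ)
      atTop (𝓝 (∫⁻ x in Ω, F x ∂μ)) := by
    refine tendsto_lintegral_of_dominated_convergence F (fun n => ?_)
      (fun n => ae_of_all _ fun x => ?_) hFint ?_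
    · exact ((hvc n).measurable.enorm.pow_const p).mul
        (ENNReal.measurable_ofReal.comp (hdm.pow_const _))
    · simp only [hF]
      refine mul_le_mul_left (ENNReal.rpow_le_rpow ?_ hp0.le) _
      rw [Real.enorm_eq_ofReal_abs, Real.enorm_eq_ofReal_abs]
      exact ENNReal.ofReal_le_ofReal (hvle n x)
    · filter_upwards [ae_restrict_mem hΩm] with x hx
      refine tendsto_const_nhds.congr' ?_
      filter_upwards [hεev x hx] with n hn
      simp only [hF, hv, distCutoff_eq_one (hεpos n) hn.le, mul_one]
  have hfin : (C : ℝ≥0∞) * 2 ^ (p - 1) ≠ ∞ := ENNReal.mul_ne_top ENNReal.coe_ne_top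
    (ENNReal.rpow_ne_top_of_nonneg (by linarith) ENNReal.ofNat_ne_top)
  have hlimR : Tendsto (fun n => (C : ℝ≥0∞) * 2 ^ (p - 1) *
      ((∫⁻ x in Ω, g x ^ p * ENNReal.ofReal (d x ^ β) ∂μ) + 2 ^ p * ∫⁻ x in Ω, F' n x ∂μ)) atTop
      (𝓝 (C * 2 ^ (p - 1) *
        ((∫⁻ x in Ω, g x ^ p * ENNReal.ofReal (d x ^ β) ∂μ) + 2 ^ p * 0))) :=
    ENNReal.Tendsto.const_mul (tendsto_const_nhds.add (ENNReal.Tendsto.const_mul hlimF'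
      (Or.inr (ENNReal.rpow_ne_top_of_nonneg hp0.le ENNReal.ofNat_ne_top)))) (Or.inr hfin)
  rw [mul_zero, add_zero] at hlimR
  refine le_trans (le_of_eq ?_) (le_of_tendsto_of_tendsto' hlimv hlimR hstep)
  refine setLIntegral_congr_fun hΩm fun x hx => ?_
  simp only [hF, hwu hx]
  rfl

end LipschitzTestFunctions

/-! ### Assembly according to the sign of `β` -/

theorem corollary6p5 {X : Type*} [MetricSpace X] [CompleteSpace X]
    [MeasurableSpace X] [BorelSpace X] (μ : Measure X)
    (hball : ∀ (x : X) (r : ℝ), 0 < r → 0 < μ (closedBall x r) ∧ μ (closedBall x r) < ∞)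
    (hdoubling : IsDoublingMeasure μ)
    (hunbounded : ¬ Bornology.IsBounded (univ : Set X))
    (p β : ℝ) (hp : 1 ≤ p) (hβ : β < p - 1)
    (hpoincare_nonpos : β ≤ 0 → SupportsPoincare μ p)
    (hpoincare_pos : 0 < β → SupportsPoincare μ (p - β))
    (Ω : Set X) (hΩ : IsOpen Ω)
    (hcodim : ENNReal.ofReal (p - β) < lowerAssouadCodim μ Ωᶜ) :
    HardyInequalityFor μ Ω p β (LipB Ω) := by
  rcases Ωᶜ.eq_empty_or_nonempty with hE | hE
  -- With empty complement the weight on the left is `∞ ^ (β - p) = 0`.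
  · refine ⟨1, one_pos, fun u _ g _ => ?_⟩
    simp only [hE, infEDist_empty, ENNReal.top_rpow_of_neg (show β - p < 0 by linarith), mul_zero,
      lintegral_zero]
    exact zero_le
  obtain ⟨D, hD⟩ := hdoubling
  simp only [lowerAssouadCodim, lt_iSup_iff] at hcodim
  obtain ⟨t, ⟨C₀, hC₀⟩, ht⟩ := hcodim
  have hpt : p - β < t := by
    rwa [← ENNReal.ofReal_coe_nnreal, ENNReal.ofReal_lt_ofReal_iff_of_nonneg (by linarith)] at ht
  have hEc : IsClosed Ωᶜ := hΩ.isClosed_compl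
  obtain ⟨C, hC⟩ : ∃ C : ℝ≥0, HardyAwayFrom μ Ωᶜ p β C := by
    rcases lt_trichotomy β 0 with hβ0 | hβ0 | hβ0
    -- A quarter of the gap keeps `p - β + δ` below the midpoint `s₁` of `p - β` and `t`; the bound
    -- `p / 2` gives `δ < p`.
    · set δ : ℝ := min ((t - (p - β)) / 4) (p / 2) with hδ
      have hδ1 : δ ≤ (t - (p - β)) / 4 := min_le_left _ _
      have hδ2 : δ ≤ p / 2 := min_le_right _ _
      obtain ⟨K, hK⟩ := exists_hardyAwayFrom_of_neg hball hD hunbounded hE hEc hC₀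
        (hpoincare_nonpos hβ0.le) (δ := δ) (s₁ := (t + (p - β)) / 2)
        (lt_min (by linarith) (by linarith)) (by linarith) (by linarith) (by linarith)
      exact ⟨_, hK β hβ0 (by linarith)⟩
    · subst hβ0
      exact exists_hardyAwayFrom_zero hball hD hunbounded hE hEc hC₀ (hpoincare_nonpos le_rfl)
        (by linarith) (by linarith)
    -- The exponent `p - β` exceeds `1` because `β < p - 1`, as the absorption argument requires.
    · obtain ⟨K, hK⟩ := exists_hardyAwayFrom_zero hball hD hunbounded hE hEc hC₀
        (hpoincare_pos hβ0) (by linarith) hpt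
      exact hK.exists_of_pos hball hE hEc hβ0 (by linarith)
  -- The summand `1` makes the constant positive even if `C = 0`.
  refine ⟨C * 2 ^ (p - 1) + 1, by positivity, fun u hu g hg => ?_⟩
  have hmain := hC.lintegral_le_of_mem_LipB hball hD hΩ hE hC₀ hp (by linarith) hpt hu hg
  have hw : ∀ x ∈ Ω, ∀ e : ℝ, infEDist x Ωᶜ ^ e = ENNReal.ofReal (infDist x Ωᶜ ^ e) := by
    intro x hx e
    have hpos : 0 < infDist x Ωᶜ := (hEc.notMem_iff_infDist_pos hE).1 (not_not.2 hx)
    rw [← ENNReal.ofReal_rpow_of_pos hpos, infDist, ENNReal.ofReal_toReal (infEDist_ne_top hE)]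
  rw [setLIntegral_congr_fun hΩ.measurableSet
      (fun x hx => congrArg (‖u x‖ₑ ^ p * ·) (hw x hx (β - p))),
    setLIntegral_congr_fun hΩ.measurableSet (fun x hx => congrArg (g x ^ p * ·) (hw x hx β))]
  refine hmain.trans (mul_le_mul_left ?_ _)
  push_cast
  rw [ENNReal.coe_rpow_of_nonneg _ (by linarith)]
  exact le_self_add
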